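/- Let $\mathcal H_A=\mathbb C^{a}$ and $\mathcal H_B=\mathbb C^{2^n}$, let $|\psi\rangle\in\mathcal H_A\otimes\mathcal H_B$ be a unit vector and $\rho=\mathrm{Tr}_A|\psi\rangle\langle\psi|\in\mathbb C^{2^n\times 2^n}$. We consider black-box quantum algorithms, which know $a$, $n$, $m$ and $\varepsilon$ but have access to $|\psi\rangle$ only through an oracle $O_\rho$: starting from a fixed state, they alternate oracle queries with arbitrary quantum channels on a finite-dimensional workspace, and finally perform a measurement and report a real number. All constants below are absolute (independent of $n,a,m,\varepsilon$ and of the oracle). 1. (Non-unitary copy-producing oracle.) Suppose $O_\rho:\sigma\mapsto\sigma\otimes|\psi\rangle\langle\psi|$. (a) There is $C>0$ such that for all $n\ge 0$, $a\ge 1$, $m\ge 0$ and $\varepsilon>0$ there is an algorithm making at most $C\,m/\varepsilon^2$ queries to $O_\rho$ which, for every unit vector $|\psi\rangle$, reports with probability greater than $2/3$ a number at distance at most $\varepsilon$ from $\mathrm{Tr}(\rho^m)$. (b) There are $c>0$ and $m_0$ such that for all $m\ge m_0$, $n\ge 1$ and $a\ge 2$, every algorithm which, for every unit vector $|\psi\rangle$,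 reports with probability at least $2/3$ a number at distance less than $1/3$ from $\mathrm{Tr}(\rho^m)$ makes at least $c\,m$ queries to $O_\rho$. 2. (Unitary purification oracle with known inverse.) Suppose $O_\rho$ is a unitary operator on $\mathcal H_A\otimes\mathcal H_B$ with $O_\rho|0\rangle=|\psi\rangle$, where $|0\rangle$ is a fixed basis vector; a query is one application of $O_\rho$ or of $O_\rho^{-1}$. (a) There is $C>0$ such that for all $n\ge 0$, $a\ge 1$, $m\ge 0$ and $\varepsilon>0$ there is an algorithm making at most $C\,m/\varepsilon$ queries which, for every unitary $O_\rho$, reports with probability greater than $2/3$ a number at distance at most $\varepsilon$ from $\mathrm{Tr}(\rho^m)$. (b) There are $c>0$ and $m_0$ such that for all $m\ge m_0$, $n\ge 1$ and $a\ge 2$, every algorithm which, for every unitary $O_\rho$, reports with probability at least $2/3$ a number at distance less than $1/3$ from $\mathrm{Tr}(\rho^m)$ makes at least $c\sqrt m$ queries, even if applications of $O_\rho$ and $O_\rho^{-1}$ controlled by a qubit are also allowed and counted as single queries. -/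

import Mathlib

open scoped Matrix Kronecker ComplexOrder

noncomputable section

namespace QuantumQuery

/-- Density matrices: positive semidefinite matrices of trace one. -/
structure IsDensity {ι : Type*} [Fintype ι] (σ : Matrix ι ι ℂ) : Prop where
  posSemidef : σ.PosSemidef
  trace_eq_one : σ.trace = 1

/-- A quantum channel (completely positive trace preserving map) from the system with basis `ι`
to the system with basis `κ`, given by a finite Kraus family `K₁, …, K_r` with `∑ Kᵢ† Kᵢ = 1`. -/
structure Channel (ι κ : Type*) [Fintype ι] [DecidableEq ι] [Fintype κ] where
  num : ℕ
  kraus : Fin num → Matrix κ ι ℂ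
  complete : ∑ i, (kraus i)ᴴ * kraus i = 1

/-- The action `σ ↦ ∑ Kᵢ σ Kᵢ†` of a channel on states. -/
def Channel.apply {ι κ : Type*} [Fintype ι] [DecidableEq ι] [Fintype κ]
    (Φ : Channel ι κ) (σ : Matrix ι ι ℂ) : Matrix κ κ ℂ :=
  ∑ i, Φ.kraus i * σ * (Φ.kraus i)ᴴ

/-- A measurement (POVM) with finitely many outcomes, together with the real number that is
reported at each outcome. -/
structure Measurement (ι : Type*) [Fintype ι] [DecidableEq ι] where
  num : ℕ
  effect : Fin num → Matrix ι ι ℂ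
  posSemidef : ∀ x, (effect x).PosSemidef
  complete : ∑ x, effect x = 1
  value : Fin num → ℝ

open Classical in
/-- The probability (Born rule) that measuring the state `σ` reports a number in the set `S`. -/
def Measurement.prob {ι : Type*} [Fintype ι] [DecidableEq ι]
    (M : Measurement ι) (σ : Matrix ι ι ℂ) (S : Set ℝ) : ℝ :=
  ∑ x with M.value x ∈ S, (M.effect x * σ).trace.re

/-- The rank one operator `|ψ⟩⟨ψ|`. -/
def ketBra {ι : Type*} (ψ : ι → ℂ) : Matrix ι ι ℂ :=
  Matrix.vecMulVec ψ (star ψ)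

/-- `ψ` is a unit vector: `⟨ψ|ψ⟩ = 1`. -/
def IsUnitVector {ι : Type*} [Fintype ι] (ψ : ι → ℂ) : Prop :=
  star ψ ⬝ᵥ ψ = 1

/-- The partial trace over the first tensor factor. -/
def partialTraceA {α β : Type*} [Fintype α] (M : Matrix (α × β) (α × β) ℂ) : Matrix β β ℂ :=
  Matrix.of fun b b' => ∑ x, M (x, b) (x, b')

/-- The state `ρ = Tr_A |ψ⟩⟨ψ|` of the second subsystem. -/
def reducedState {α β : Type*} [Fintype α] (ψ : α × β → ℂ) : Matrix β β ℂ :=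
  partialTraceA (ketBra ψ)

/-- The numbers within distance `ε` of `Tr (ρ ^ m)`. -/
def within {β : Type*} [Fintype β] [DecidableEq β] (ρ : Matrix β β ℂ) (m : ℕ) (ε : ℝ) : Set ℝ :=
  {v | ‖(v : ℂ) - (ρ ^ m).trace‖ ≤ ε}

/-- The numbers at distance less than `ε` from `Tr (ρ ^ m)`. -/
def strictlyWithin {β : Type*} [Fintype β] [DecidableEq β]
    (ρ : Matrix β β ℂ) (m : ℕ) (ε : ℝ) : Set ℝ :=
  {v | ‖(v : ℂ) - (ρ ^ m).trace‖ < ε}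

/-! ### The copy-producing (non-unitary) oracle -/

/-- The oracle `σ ↦ σ ⊗ |ψ⟩⟨ψ|`. -/
def copyOracle {ι κ : Type*} (ψ : κ → ℂ) (σ : Matrix ι ι ℂ) : Matrix (ι × κ) (ι × κ) ℂ :=
  σ ⊗ₖ ketBra ψ

/-- A black-box algorithm with access to a copy-producing oracle on `ℂ^a ⊗ ℂ^d`.
It has a workspace of some finite dimension, starts in a fixed state, and then repeats
"call the oracle, apply a channel that takes the workspace and the new copy back to the
workspace"; each entry of `steps` is one such round, hence one query. (Storing the copy,
discarding subsystems, intermediate measurements and classical control are channels.)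
At the end it measures the workspace and reports a real number. -/
structure CopyAlgorithm (a d : ℕ) where
  dim : ℕ
  start : Matrix (Fin dim) (Fin dim) ℂ
  start_isDensity : IsDensity start
  steps : List (Channel (Fin dim × (Fin a × Fin d)) (Fin dim))
  readout : Measurement (Fin dim)

namespace CopyAlgorithm

variable {a d : ℕ}

/-- The number of oracle queries. -/
def queries (alg : CopyAlgorithm a d) : ℕ := alg.steps.length

/-- The final state of the workspace when the oracle appends `|ψ⟩⟨ψ|`. -/
def finalState (alg : CopyAlgorithm a d) (ψ : Fin a × Fin d → ℂ) :
    Matrix (Fin alg.dim) (Fin alg.dim) ℂ :=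
  alg.steps.foldl (fun σ Φ => Φ.apply (copyOracle ψ σ)) alg.start

/-- The probability that the number reported by the algorithm lies in `S`. -/
def outputProb (alg : CopyAlgorithm a d) (ψ : Fin a × Fin d → ℂ) (S : Set ℝ) : ℝ :=
  alg.readout.prob (alg.finalState ψ) S

end CopyAlgorithm

/-! ### The unitary oracle with known inverse -/

/-- The state `|ψ⟩ = U |0⟩` prepared by the unitary oracle `U` on `ℂ^a ⊗ ℂ^d`, where `|0⟩` is the
basis vector `|0⟩ ⊗ |0⟩`. -/
def preparedState {a d : ℕ} [NeZero a] [NeZero d]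
    (U : Matrix (Fin a × Fin d) (Fin a × Fin d) ℂ) : Fin a × Fin d → ℂ :=
  U *ᵥ Pi.single (0, 0) 1

/-- A single call: to the oracle or to its inverse, plain or controlled by a qubit. -/
structure OracleCall where
  inverse : Bool
  controlled : Bool

/-- Basis of the algorithm's register: a control qubit, a workspace of dimension `w`, and the
target `ℂ^a ⊗ ℂ^d` of the oracle. -/
abbrev Register (w a d : ℕ) : Type := Fin 2 × Fin w × (Fin a × Fin d)

/-- The operator applied to the register by an oracle call: with `V = U` or `V = U†`, this is
`1 ⊗ 1 ⊗ V` for a plain call and `|0⟩⟨0| ⊗ 1 ⊗ 1 + |1⟩⟨1| ⊗ 1 ⊗ V` for a controlled one. -/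
def OracleCall.toMatrix {a d : ℕ} (c : OracleCall) (w : ℕ)
    (U : Matrix (Fin a × Fin d) (Fin a × Fin d) ℂ) :
    Matrix (Register w a d) (Register w a d) ℂ :=
  let V : Matrix (Fin a × Fin d) (Fin a × Fin d) ℂ := if c.inverse then Uᴴ else U
  let I : Matrix (Fin w) (Fin w) ℂ := 1
  if c.controlled then
    Matrix.diagonal ![1, 0] ⊗ₖ (I ⊗ₖ (1 : Matrix (Fin a × Fin d) (Fin a × Fin d) ℂ))
      + Matrix.diagonal ![0, 1] ⊗ₖ (I ⊗ₖ V)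
  else
    (1 : Matrix (Fin 2) (Fin 2) ℂ) ⊗ₖ (I ⊗ₖ V)

/-- A black-box algorithm with access to a unitary oracle on `ℂ^a ⊗ ℂ^d` and its inverse.
It starts in a fixed state of its register and then repeats "call the oracle, apply a channel";
each entry of `steps` is one such round, hence one query. At the end it measures the
register and reports a real number. -/
structure UnitaryAlgorithm (a d : ℕ) where
  dim : ℕ
  start : Matrix (Register dim a d) (Register dim a d) ℂ
  start_isDensity : IsDensity start
  steps : List (OracleCall × Channel (Register dim a d) (Register dim a d))
  readout : Measurement (Register dim a d)

namespace UnitaryAlgorithm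

variable {a d : ℕ}

/-- The number of oracle queries (to the oracle or its inverse, controlled or not). -/
def queries (alg : UnitaryAlgorithm a d) : ℕ := alg.steps.length

/-- The algorithm never uses controlled calls, only the oracle and its inverse themselves. -/
def UsesPlainCalls (alg : UnitaryAlgorithm a d) : Prop :=
  ∀ s ∈ alg.steps, s.1.controlled = false

/-- The final state of the register when the oracle is `U`. -/
def finalState (alg : UnitaryAlgorithm a d) (U : Matrix (Fin a × Fin d) (Fin a × Fin d) ℂ) :
    Matrix (Register alg.dim a d) (Register alg.dim a d) ℂ :=
  alg.steps.foldl
    (fun σ s => s.2.apply (s.1.toMatrix alg.dim U * σ * (s.1.toMatrix alg.dim U)ᴴ)) alg.start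

/-- The probability that the number reported by the algorithm lies in `S`. -/
def outputProb (alg : UnitaryAlgorithm a d) (U : Matrix (Fin a × Fin d) (Fin a × Fin d) ℂ)
    (S : Set ℝ) : ℝ :=
  alg.readout.prob (alg.finalState U) S

end UnitaryAlgorithm

end QuantumQuery

end

/-! Let `P` cyclically permute the second components of `m` copies of `ψ`. The first components stay
in place and are traced out, so `⟨ψ^⊗m, P ψ^⊗m⟩` is a sum over closed walks of length `m`, namely
`Tr (ρ ^ m) = μ`. Both algorithms estimate this mean by the spectral measurement of a Hermitian
observable `A` in a unit vector `v`. By Chebyshev (`lt_spectralMeasurement_prob`) it suffices that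
`‖(A - μ) v‖² < ε² / 3`.

With copies, `A` is the average over `k ≈ 4 / ε²` blocks of the Hermitian part of `P`. The
deviations in different blocks are orthogonal, so the variance is at most `1 / k`, at the price of
`k m` copies.

With a unitary oracle, a control qubit in a uniform superposition turns `P` into an involution `G`
with `⟨Ψ, G Ψ⟩ = μ`. The vectors `u_t = (R_Ψ G)^t Ψ`, with `R_Ψ` the reflection about `Ψ`, obey the
Chebyshev recurrence `u_{t+2} + u_t = 2 μ u_{t+1}` (`iterate_add_iterate`). Hence the superposition
of `|t⟩ u_t` with slowly varying amplitudes `w_t = t (N + 1 - t)` is nearly an eigenvector, with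
eigenvalue `μ`, of half the adjacency matrix of a path acting on the clock. The error is governed by
the increments of `w`: the variance is at most `N³ / (N⁵ / 30) = 30 / N²`, so `N ≈ 10 / ε` rounds of
`2 m` calls suffice. This replaces phase estimation and its Fourier transform.

Both lower bounds compare `|00⟩` with `cos 2θ |00⟩ + sin 2θ |11⟩`, where `sin² θ = 1 / m`. The power
trace is `1` for the former and at most `1 / 3` for the latter. Runs are followed on purifications,
where channels are isometries. Copies multiply the inner product by `1 - 2 / m` per query, which
gives `Ω(m)`; the oracles are reflections at Frobenius distance `√(8 / m)`, and a hybrid argument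
gives `Ω(√m)`. -/

noncomputable section

namespace QuantumQuery

open Matrix

/-! ### Squared norms of vectors -/

/-- The squared Euclidean norm of a vector. -/
def nsq {ι : Type*} [Fintype ι] (v : ι → ℂ) : ℝ := ∑ i, ‖v i‖ ^ 2

section nsq

variable {ι κ : Type*} [Fintype ι] [Fintype κ]

lemma star_mul_self_eq_norm_sq (z : ℂ) : star z * z = ((‖z‖ ^ 2 : ℝ) : ℂ) := by
  rw [Complex.star_def, Complex.conj_mul']; push_cast; rfl

lemma star_dotProduct_self (v : ι → ℂ) : star v ⬝ᵥ v = (nsq v : ℂ) := by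
  simp only [dotProduct, nsq, Pi.star_apply, star_mul_self_eq_norm_sq, Complex.ofReal_sum]

lemma isUnitVector_iff (v : ι → ℂ) : IsUnitVector v ↔ nsq v = 1 := by
  rw [IsUnitVector, star_dotProduct_self]; norm_cast

lemma nsq_nonneg (v : ι → ℂ) : 0 ≤ nsq v := Finset.sum_nonneg fun _ _ => by positivity

lemma nsq_smul (c : ℂ) (v : ι → ℂ) : nsq (c • v) = ‖c‖ ^ 2 * nsq v := by
  simp [nsq, Finset.mul_sum, mul_pow]

lemma nsq_comp_equiv (e : ι ≃ κ) (v : κ → ℂ) : nsq (v ∘ e) = nsq v :=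
  e.sum_comp fun i => ‖v i‖ ^ 2

/-- Convexity of the square. It disposes of cross terms both for the two permutations in the
Hermitian part and for the two neighbours of a clock time. -/
lemma nsq_half_smul_add_le (r s : ℝ) (v w : ι → ℂ) :
    nsq ((1 / 2 : ℂ) • ((r : ℂ) • v + (s : ℂ) • w)) ≤ (r ^ 2 * nsq v + s ^ 2 * nsq w) / 2 := by
  simp only [nsq, Finset.mul_sum, ← Finset.sum_add_distrib, Finset.sum_div]
  refine Finset.sum_le_sum fun i _ => ?_
  simp only [Pi.smul_apply, Pi.add_apply, smul_eq_mul, norm_mul]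
  have h := norm_add_le ((r : ℂ) * v i) ((s : ℂ) * w i)
  simp only [norm_mul, Complex.norm_real, Real.norm_eq_abs] at h
  have h1 : ‖(1 / 2 : ℂ)‖ = 1 / 2 := by norm_num
  rw [h1, mul_pow]
  have h2 : ‖(r : ℂ) * v i + (s : ℂ) * w i‖ ^ 2 ≤ (|r| * ‖v i‖ + |s| * ‖w i‖) ^ 2 := by
    gcongr
  have h3 := sq_nonneg (|r| * ‖v i‖ - |s| * ‖w i‖)
  have hr := sq_abs r
  have hs := sq_abs s
  rw [← hr, ← hs]
  nlinarith

lemma star_mulVec_dotProduct (A : Matrix ι κ ℂ) (v : κ → ℂ) (w : ι → ℂ) :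
    star (A *ᵥ v) ⬝ᵥ w = star v ⬝ᵥ (Aᴴ *ᵥ w) := by
  rw [star_mulVec, dotProduct_mulVec]

lemma nsq_mulVec_of_conjTranspose_mul [DecidableEq κ] {A : Matrix ι κ ℂ} (hA : Aᴴ * A = 1)
    (v : κ → ℂ) : nsq (A *ᵥ v) = nsq v := by
  have : (nsq (A *ᵥ v) : ℂ) = nsq v := by
    rw [← star_dotProduct_self, star_mulVec_dotProduct, mulVec_mulVec, hA, one_mulVec,
      star_dotProduct_self]
  exact_mod_cast this

lemma nsq_unitary_mulVec [DecidableEq ι] {A : Matrix ι ι ℂ} (hA : A ∈ unitaryGroup ι ℂ)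
    (v : ι → ℂ) : nsq (A *ᵥ v) = nsq v :=
  nsq_mulVec_of_conjTranspose_mul (mem_unitaryGroup_iff'.1 hA) v

/-- The second moment identity: if `⟨v, A v⟩ = μ` with `A` Hermitian and `v` a unit vector, then
`‖(A - μ) v‖² = ‖A v‖² - μ²`. -/
lemma nsq_mulVec_sub_smul {A : Matrix ι ι ℂ} (hA : A.IsHermitian) {v : ι → ℂ} (hv : nsq v = 1)
    {μ : ℝ} (hμ : star v ⬝ᵥ (A *ᵥ v) = μ) :
    nsq (A *ᵥ v - (μ : ℂ) • v) = nsq (A *ᵥ v) - μ ^ 2 := by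
  have h1 : star (A *ᵥ v) ⬝ᵥ v = μ := by rw [star_mulVec_dotProduct, hA.eq, hμ]
  have h : (nsq (A *ᵥ v - (μ : ℂ) • v) : ℂ) = ((nsq (A *ᵥ v) - μ ^ 2 : ℝ) : ℂ) := by
    rw [← star_dotProduct_self, star_sub, star_smul, sub_dotProduct, dotProduct_sub,
      dotProduct_sub, smul_dotProduct, smul_dotProduct, dotProduct_smul, dotProduct_smul, h1, hμ,
      star_dotProduct_self, star_dotProduct_self, hv]
    simp
    ring
  exact_mod_cast h

end nsq

/-! ### Rank one operators -/

section ketBra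

variable {ι κ : Type*}

lemma conjTranspose_ketBra (v : ι → ℂ) : (ketBra v)ᴴ = ketBra v := by
  simp [ketBra, conjTranspose_vecMulVec]

lemma ketBra_comp (e : κ → ι) (v : ι → ℂ) : ketBra (v ∘ e) = (ketBra v).submatrix e e := rfl

/-- The reflection `2|v⟩⟨v| - 1`. -/
def reflection [DecidableEq ι] (v : ι → ℂ) : Matrix ι ι ℂ := (2 : ℂ) • ketBra v - 1

lemma conjTranspose_reflection [DecidableEq ι] (v : ι → ℂ) : (reflection v)ᴴ = reflection v := by
  simp [reflection, conjTranspose_ketBra]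

variable [Fintype ι]

lemma mul_ketBra_mul (A : Matrix κ ι ℂ) (v : ι → ℂ) : A * ketBra v * Aᴴ = ketBra (A *ᵥ v) := by
  rw [ketBra, ketBra, mul_vecMulVec, vecMulVec_mul, star_mulVec]

lemma trace_ketBra (v : ι → ℂ) : (ketBra v).trace = (nsq v : ℂ) := by
  rw [ketBra, trace_vecMulVec, dotProduct_comm, star_dotProduct_self]

lemma posSemidef_ketBra (v : ι → ℂ) : (ketBra v).PosSemidef := posSemidef_vecMulVec_self_star v

lemma isDensity_ketBra {v : ι → ℂ} (hv : nsq v = 1) : IsDensity (ketBra v) :=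
  ⟨posSemidef_ketBra v, by rw [trace_ketBra, hv]; simp⟩

lemma ketBra_mulVec (v w : ι → ℂ) : ketBra v *ᵥ w = (star v ⬝ᵥ w) • v := by
  rw [ketBra, vecMulVec_mulVec, op_smul_eq_smul]

lemma ketBra_mul_ketBra (v w : ι → ℂ) :
    ketBra v * ketBra w = (star v ⬝ᵥ w) • vecMulVec v (star w) := by
  rw [ketBra, ketBra, vecMulVec_mul_vecMulVec, vecMulVec_smul]

lemma trace_ketBra_mul_ketBra (v w : ι → ℂ) :
    (ketBra v * ketBra w).trace = ((‖star v ⬝ᵥ w‖ ^ 2 : ℝ) : ℂ) := by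
  rw [ketBra_mul_ketBra, trace_smul, trace_vecMulVec, dotProduct_comm v, smul_eq_mul,
    ← star_mul_self_eq_norm_sq, mul_comm, ← star_dotProduct_star, star_star]

variable [DecidableEq ι]

lemma reflection_mul_self {v : ι → ℂ} (hv : nsq v = 1) : reflection v * reflection v = 1 := by
  have h : ketBra v * ketBra v = ketBra v := by
    rw [ketBra_mul_ketBra, star_dotProduct_self, hv, Complex.ofReal_one, one_smul]; rfl
  simp only [reflection, sub_mul, mul_sub, smul_mul_assoc, mul_smul_comm, h, one_mul, mul_one]
  module

lemma reflection_mem_unitaryGroup {v : ι → ℂ} (hv : nsq v = 1) :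
    reflection v ∈ unitaryGroup ι ℂ := by
  rw [mem_unitaryGroup_iff, star_eq_conjTranspose, conjTranspose_reflection,
    reflection_mul_self hv]

lemma reflection_mulVec (v w : ι → ℂ) :
    reflection v *ᵥ w = (2 * (star v ⬝ᵥ w)) • v - w := by
  rw [reflection, sub_mulVec, one_mulVec, smul_mulVec, ketBra_mulVec]
  module

/-- This makes the reflection about an unknown prepared state available: prepare it by `W` from a
known state, and conjugate the known reflection. -/
lemma mul_reflection_mul {W : Matrix ι ι ℂ} (hW : W ∈ unitaryGroup ι ℂ) (v : ι → ℂ) :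
    W * reflection v * Wᴴ = reflection (W *ᵥ v) := by
  have h : W * Wᴴ = 1 := mem_unitaryGroup_iff.1 hW
  rw [reflection, reflection, mul_sub, sub_mul, mul_one, h, mul_smul_comm, smul_mul_assoc,
    mul_ketBra_mul]

end ketBra

/-! ### Measuring a Hermitian observable -/

section spectral

variable {ι : Type*} [Fintype ι] [DecidableEq ι]

/-- The projective measurement of a Hermitian observable, reporting the eigenvalue. -/
def spectralMeasurement {A : Matrix ι ι ℂ} (hA : A.IsHermitian) : Measurement ι where
  num := Fintype.card ι
  effect x := ketBra fun i => (hA.eigenvectorUnitary : Matrix ι ι ℂ) i ((Fintype.equivFin ι).symm x)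
  posSemidef _ := posSemidef_ketBra _
  complete := by
    rw [(Fintype.equivFin ι).symm.sum_comp
      fun y => ketBra fun i => (hA.eigenvectorUnitary : Matrix ι ι ℂ) i y]
    rw [← mem_unitaryGroup_iff.1 hA.eigenvectorUnitary.2]
    ext i j
    simp [ketBra, vecMulVec_apply, Matrix.sum_apply, mul_apply]
  value x := hA.eigenvalues ((Fintype.equivFin ι).symm x)

lemma Measurement.prob_add_prob_compl (M : Measurement ι) (σ : Matrix ι ι ℂ) (S : Set ℝ) :
    M.prob σ S + M.prob σ Sᶜ = σ.trace.re := by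
  classical
  have h : σ.trace.re = ∑ x, (M.effect x * σ).trace.re := by
    rw [← Complex.re_sum, ← trace_sum, ← Finset.sum_mul, M.complete, one_mul]
  rw [h, Measurement.prob, Measurement.prob,
    ← Finset.sum_filter_add_sum_filter_not Finset.univ fun x => M.value x ∈ S]
  congr!

/-- Chebyshev's inequality for the measurement of an observable in a pure state. -/
lemma lt_spectralMeasurement_prob {A : Matrix ι ι ℂ} (hA : A.IsHermitian) {v : ι → ℂ}
    (hv : nsq v = 1) {μ ε : ℝ} (hε : 0 < ε)
    (h : nsq (A *ᵥ v - (μ : ℂ) • v) < ε ^ 2 / 3) {S : Set ℝ} (hS : ∀ x, |x - μ| ≤ ε → x ∈ S) :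
    2 / 3 < (spectralMeasurement hA).prob (ketBra v) S := by
  classical
  set V : Matrix ι ι ℂ := (hA.eigenvectorUnitary : Matrix ι ι ℂ) with hV
  have hVu : V ∈ unitaryGroup ι ℂ := hA.eigenvectorUnitary.2
  set D : Matrix ι ι ℂ := diagonal fun i => (hA.eigenvalues i : ℂ) with hD
  have hVD : Vᴴ * A = D * Vᴴ := by
    have h1 : A = V * D * star V := by
      have := hA.spectral_theorem
      rwa [Unitary.conjStarAlgAut_apply] at this
    have h2 : Vᴴ * V = 1 := mem_unitaryGroup_iff'.1 hVu
    conv_lhs => rw [h1]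
    rw [← mul_assoc, ← mul_assoc, h2, one_mul]; rfl
  set z := Vᴴ *ᵥ v with hz
  have hp : ∀ T : Set ℝ, (spectralMeasurement hA).prob (ketBra v) T
      = ∑ i with hA.eigenvalues i ∈ T, ‖z i‖ ^ 2 := by
    intro T
    rw [Measurement.prob, Finset.sum_filter, Finset.sum_filter]
    refine Eq.trans ?_ ((Fintype.equivFin ι).symm.sum_comp
      fun i => if hA.eigenvalues i ∈ T then ‖z i‖ ^ 2 else 0)
    refine Finset.sum_congr rfl fun x _ => ?_
    have : (spectralMeasurement hA).value x
      = hA.eigenvalues ((Fintype.equivFin ι).symm x) := rfl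
    rw [this]
    refine if_congr Iff.rfl ?_ rfl
    have h3 : (spectralMeasurement hA).effect x
      = ketBra fun i => V i ((Fintype.equivFin ι).symm x) := rfl
    rw [h3, trace_ketBra_mul_ketBra, Complex.ofReal_re]
    rfl
  -- The weights `‖z i‖²` are the outcome probabilities, so the left side is the second moment about
  -- `μ` of the reported number.
  have hvar : nsq (A *ᵥ v - (μ : ℂ) • v) = ∑ i, (hA.eigenvalues i - μ) ^ 2 * ‖z i‖ ^ 2 := by
    have h4 : Vᴴ ∈ unitaryGroup ι ℂ := Unitary.star_mem hVu
    rw [← nsq_unitary_mulVec h4, mulVec_sub, mulVec_smul, mulVec_mulVec, hVD, ← mulVec_mulVec,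
      ← hz, nsq]
    refine Finset.sum_congr rfl fun i _ => ?_
    rw [hD, Pi.sub_apply, mulVec_diagonal, Pi.smul_apply, smul_eq_mul, ← sub_mul, norm_mul,
      mul_pow, ← Complex.ofReal_sub, Complex.norm_real, Real.norm_eq_abs, sq_abs]
  have hc : (spectralMeasurement hA).prob (ketBra v) Sᶜ ≤ nsq (A *ᵥ v - (μ : ℂ) • v) / ε ^ 2 := by
    rw [hp, hvar, Finset.sum_filter, Finset.sum_div]
    refine Finset.sum_le_sum fun i _ => ?_
    split_ifs with hi
    · rw [le_div_iff₀ (by positivity), mul_comm]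
      have h5 : ε < |hA.eigenvalues i - μ| := by
        by_contra hcon
        exact hi (hS _ (not_lt.1 hcon))
      have h6 : ε ^ 2 ≤ (hA.eigenvalues i - μ) ^ 2 := by
        rw [← sq_abs (hA.eigenvalues i - μ)]; gcongr
      gcongr
    · positivity
  have ht := (spectralMeasurement hA).prob_add_prob_compl (ketBra v) S
  rw [trace_ketBra, hv, Complex.ofReal_re] at ht
  have : nsq (A *ᵥ v - (μ : ℂ) • v) / ε ^ 2 < 1 / 3 := by
    rw [div_lt_iff₀ (by positivity)]; linarith
  linarith

end spectral

/-! ### Tensor powers -/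

section piTensor

variable {ι κ : Type*} [Fintype ι]

/-- The tensor product of a family of vectors. -/
def piVec (v : ι → κ → ℂ) : (ι → κ) → ℂ := fun w => ∏ i, v i (w i)

variable [DecidableEq ι] [Fintype κ]

lemma star_piVec_dotProduct_piVec (v w : ι → κ → ℂ) :
    star (piVec v) ⬝ᵥ piVec w = ∏ i, star (v i) ⬝ᵥ w i := by
  simp only [dotProduct, piVec, Pi.star_apply, star_prod, ← Finset.prod_mul_distrib]
  exact (Fintype.prod_sum fun i y => star (v i y) * w i y).symm

lemma nsq_piVec (v : ι → κ → ℂ) : nsq (piVec v) = ∏ i, nsq (v i) := by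
  have h : (nsq (piVec v) : ℂ) = ((∏ i, nsq (v i) : ℝ) : ℂ) := by
    rw [← star_dotProduct_self, star_piVec_dotProduct_piVec, Complex.ofReal_prod]
    exact Finset.prod_congr rfl fun i _ => star_dotProduct_self _
  exact_mod_cast h

variable [DecidableEq κ]

/-- The tensor product of a family of matrices, as a monoid homomorphism. -/
def piTensor (ι κ : Type*) [Fintype ι] [DecidableEq ι] [Fintype κ] [DecidableEq κ] :
    (ι → Matrix κ κ ℂ) →* Matrix (ι → κ) (ι → κ) ℂ where
  toFun M := Matrix.of fun w w' => ∏ i, M i (w i) (w' i)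
  map_one' := by
    ext w w'
    simp only [of_apply, Pi.one_apply, one_apply, Finset.prod_ite_zero, Finset.mem_univ,
      forall_true_left, Finset.prod_const_one, funext_iff]
  map_mul' M N := by
    ext w w'
    simp only [of_apply, Pi.mul_apply, mul_apply, ← Finset.prod_mul_distrib]
    exact Fintype.prod_sum fun i y => M i (w i) y * N i y (w' i)

lemma piTensor_apply (M : ι → Matrix κ κ ℂ) (w w' : ι → κ) :
    piTensor ι κ M w w' = ∏ i, M i (w i) (w' i) := rfl

lemma conjTranspose_piTensor (M : ι → Matrix κ κ ℂ) :
    (piTensor ι κ M)ᴴ = piTensor ι κ fun i => (M i)ᴴ := by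
  ext w w'
  simp only [conjTranspose_apply, piTensor_apply, star_prod]

lemma piTensor_mulVec_piVec (M : ι → Matrix κ κ ℂ) (v : ι → κ → ℂ) :
    piTensor ι κ M *ᵥ piVec v = piVec fun i => M i *ᵥ v i := by
  ext w
  simp only [mulVec, dotProduct, piVec, piTensor_apply, ← Finset.prod_mul_distrib]
  exact (Fintype.prod_sum fun i y => M i (w i) y * v i y).symm

end piTensor

/-! ### Traces of powers as cyclic sums -/

section trace

variable {β : Type*} [Fintype β] [DecidableEq β]

/-- The weight `g` on the endpoints is arbitrary so that the induction can remove the first vertex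
of a walk and absorb its edge into `g`. -/
lemma sum_prod_walk (M : Matrix β β ℂ) (n : ℕ) (g : β → β → ℂ) :
    ∑ f : Fin (n + 1) → β, g (f 0) (f (Fin.last n)) * ∏ i : Fin n, M (f i.castSucc) (f i.succ)
      = ∑ x, ∑ y, g x y * (M ^ n) x y := by
  induction n generalizing g with
  | zero =>
    rw [← (Equiv.funUnique (Fin 1) β).symm.sum_comp]
    simp [one_apply]
  | succ n ih =>
    rw [← (Fin.consEquiv fun _ => β).sum_comp, Fintype.sum_prod_type, Finset.sum_comm]
    have h := ih fun y z => ∑ x, g x z * M x y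
    simp only [Fin.consEquiv_apply, Fin.prod_univ_succ (n := n), Fin.castSucc_zero, Fin.cons_zero,
      Fin.cons_succ, ← Fin.succ_castSucc, ← Fin.succ_last] at h ⊢
    calc _ = ∑ f : Fin (n + 1) → β, (∑ x, g x (f (Fin.last n)) * M x (f 0)) *
          ∏ i : Fin n, M (f i.castSucc) (f i.succ) := by
          refine Finset.sum_congr rfl fun f _ => ?_
          rw [Finset.sum_mul]
          exact Finset.sum_congr rfl fun x _ => by ring
      _ = ∑ y, ∑ z, ∑ x, g x z * (M x y * (M ^ n) y z) := by
          rw [h]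
          simp only [Finset.sum_mul, mul_assoc]
      _ = _ := by
          simp only [pow_succ', mul_apply, Finset.mul_sum]
          rw [Finset.sum_comm' (t' := Finset.univ) (s' := fun _ => Finset.univ) (by simp)]
          rw [Finset.sum_congr rfl fun z _ => Finset.sum_comm]
          exact Finset.sum_comm

lemma sum_prod_finRotate (M : Matrix β β ℂ) {m : ℕ} (hm : m ≠ 0) :
    ∑ f : Fin m → β, ∏ i, M (f i) (f (finRotate m i)) = (M ^ m).trace := by
  obtain ⟨n, rfl⟩ := Nat.exists_eq_succ_of_ne_zero hm
  -- The endpoint weight is the edge that closes the walk to a cycle.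
  have h := sum_prod_walk M n fun x y => M y x
  calc _ = ∑ f : Fin (n + 1) → β, M (f (Fin.last n)) (f 0) *
        ∏ i : Fin n, M (f i.castSucc) (f i.succ) := by
        refine Finset.sum_congr rfl fun f _ => ?_
        rw [Fin.prod_univ_castSucc, mul_comm]
        simp [Fin.coeSucc_eq_succ]
    _ = _ := by
        rw [h, pow_succ, trace]
        simp only [diag_apply, mul_apply, mul_comm]

end trace

/-! ### The cyclic permutation test -/

section cyclic

variable {ι α β : Type*}

/-- The permutation of basis states that permutes the second components of the registers. -/
def permuteB (σ : Equiv.Perm ι) : Equiv.Perm (ι → α × β) where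
  toFun w i := ((w i).1, (w (σ i)).2)
  invFun w i := ((w i).1, (w (σ.symm i)).2)
  left_inv w := by ext i <;> simp
  right_inv w := by ext i <;> simp

variable [Fintype ι] [DecidableEq ι] [Fintype α]

lemma reducedState_apply (ψ : α × β → ℂ) (b b' : β) :
    reducedState ψ b b' = ∑ x, ψ (x, b) * star (ψ (x, b')) := by
  simp [reducedState, partialTraceA, ketBra, vecMulVec_apply]

lemma conjTranspose_reducedState (ψ : α × β → ℂ) : (reducedState ψ)ᴴ = reducedState ψ := by
  ext b b'
  simp [reducedState_apply, mul_comm]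

variable [Fintype β]

/-- Bra and ket share the first component of each factor; summing it out leaves one entry of the
reduced state per factor. The transpose appears because the bra carries `f i` and the ket `f (σ i)`.
-/
lemma star_piVec_dotProduct_piVec_comp_permuteB (ψ : α × β → ℂ) (σ : Equiv.Perm ι) :
    star (piVec fun _ : ι => ψ) ⬝ᵥ (piVec (fun _ : ι => ψ) ∘ permuteB σ)
      = ∑ f : ι → β, ∏ i, (reducedState ψ)ᵀ (f i) (f (σ i)) := by
  simp only [dotProduct, piVec, Pi.star_apply, star_prod, Function.comp_apply,
    ← Finset.prod_mul_distrib, permuteB, Equiv.coe_fn_mk, transpose_apply, reducedState_apply]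
  rw [← (Equiv.arrowProdEquivProdArrow ι (fun _ => α) (fun _ => β)).symm.sum_comp,
    Fintype.sum_prod_type, Finset.sum_comm]
  refine Finset.sum_congr rfl fun f _ => ?_
  rw [Fintype.prod_sum]
  refine Finset.sum_congr rfl fun g _ => Finset.prod_congr rfl fun i _ => ?_
  simp [Equiv.arrowProdEquivProdArrow, mul_comm]

variable [DecidableEq β]

/-- The number `Tr (ρ ^ m)` as a real number. -/
def powerTrace (ρ : Matrix β β ℂ) (m : ℕ) : ℝ := (ρ ^ m).trace.re

lemma ofReal_powerTrace_reducedState (ψ : α × β → ℂ) (m : ℕ) :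
    (powerTrace (reducedState ψ) m : ℂ) = (reducedState ψ ^ m).trace := by
  refine Complex.conj_eq_iff_re.1 ?_
  rw [← Complex.star_def, ← trace_conjTranspose, conjTranspose_pow, conjTranspose_reducedState]

lemma star_piVec_dotProduct_comp_permuteB_finRotate (ψ : α × β → ℂ) {m : ℕ} (hm : m ≠ 0) :
    star (piVec fun _ : Fin m => ψ) ⬝ᵥ (piVec (fun _ : Fin m => ψ) ∘ permuteB (finRotate m))
      = powerTrace (reducedState ψ) m := by
  rw [star_piVec_dotProduct_piVec_comp_permuteB, sum_prod_finRotate _ hm, ← transpose_pow,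
    trace_transpose, ofReal_powerTrace_reducedState]

/-- The inverse permutation has the conjugate expectation, and the power trace is real. -/
lemma star_piVec_dotProduct_comp_permuteB_finRotate_symm (ψ : α × β → ℂ) {m : ℕ} (hm : m ≠ 0) :
    star (piVec fun _ : Fin m => ψ) ⬝ᵥ
        (piVec (fun _ : Fin m => ψ) ∘ (permuteB (finRotate m)).symm)
      = powerTrace (reducedState ψ) m := by
  have h := star_piVec_dotProduct_comp_permuteB_finRotate ψ hm
  rw [← Complex.conj_ofReal, ← h, ← Complex.star_def, ← star_dotProduct_star, star_star,
    dotProduct_comm]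
  simp only [dotProduct]
  rw [← Equiv.sum_comp (permuteB (finRotate m))]
  simp [mul_comm]

lemma within_mem_iff (ψ : α × β → ℂ) (m : ℕ) (ε x : ℝ) :
    x ∈ within (reducedState ψ) m ε ↔ |x - powerTrace (reducedState ψ) m| ≤ ε := by
  rw [within, Set.mem_ofPred_eq, ← ofReal_powerTrace_reducedState, ← Complex.ofReal_sub,
    Complex.norm_real, Real.norm_eq_abs]

lemma strictlyWithin_mem_iff (ψ : α × β → ℂ) (m : ℕ) (ε x : ℝ) :
    x ∈ strictlyWithin (reducedState ψ) m ε ↔ |x - powerTrace (reducedState ψ) m| < ε := by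
  rw [strictlyWithin, Set.mem_ofPred_eq, ← ofReal_powerTrace_reducedState, ← Complex.ofReal_sub,
    Complex.norm_real, Real.norm_eq_abs]

end cyclic

open scoped MatrixOrder in
lemma exists_eq_conjTranspose_mul_self {ι : Type*} [Fintype ι] {E : Matrix ι ι ℂ}
    (hE : E.PosSemidef) : ∃ B : Matrix ι ι ℂ, E = Bᴴ * B := by
  classical
  exact CStarAlgebra.nonneg_iff_eq_star_mul_self.1 hE.nonneg

/-! ### Purifications and distinguishability -/

section purification

open scoped Matrix.Norms.Frobenius

variable {ι κ l : Type*} [Fintype ι] [Fintype κ]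

/-- The purified action of a channel on a matrix `Z`, seen as a purification of `Z Z†`. -/
def Channel.dilate [DecidableEq ι] (Φ : Channel ι κ) (Z : Matrix ι l ℂ) :
    Matrix κ (l × Fin Φ.num) ℂ :=
  Matrix.of fun i p => (Φ.kraus p.2 * Z) i p.1

lemma Channel.dilate_sub [DecidableEq ι] (Φ : Channel ι κ) (Y Z : Matrix ι l ℂ) :
    Φ.dilate (Y - Z) = Φ.dilate Y - Φ.dilate Z := by
  ext i p
  simp [Channel.dilate, Matrix.mul_sub]

variable [Fintype l]

lemma frobenius_norm_sq (X : Matrix κ l ℂ) : ‖X‖ ^ 2 = (Xᴴ * X).trace.re := by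
  rw [frobenius_norm_def, ← Real.sqrt_eq_rpow, Real.sq_sqrt (by positivity), Finset.sum_comm]
  simp only [trace, diag_apply, mul_apply, conjTranspose_apply, star_mul_self_eq_norm_sq,
    Complex.re_sum, Complex.ofReal_re, Real.rpow_ofNat]

lemma norm_eq_one_of_isDensity {X : Matrix ι l ℂ} (h : IsDensity (X * Xᴴ)) : ‖X‖ = 1 := by
  have h1 : ‖X‖ ^ 2 = 1 := by
    rw [frobenius_norm_sq, trace_mul_comm, h.trace_eq_one, Complex.one_re]
  nlinarith [norm_nonneg X]

variable [DecidableEq ι]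

lemma Channel.dilate_mul_conjTranspose (Φ : Channel ι κ) (Z : Matrix ι l ℂ) :
    Φ.dilate Z * (Φ.dilate Z)ᴴ = Φ.apply (Z * Zᴴ) := by
  have h : Φ.apply (Z * Zᴴ) = ∑ i, (Φ.kraus i * Z) * (Φ.kraus i * Z)ᴴ := by
    simp only [Channel.apply, conjTranspose_mul, Matrix.mul_assoc]
  rw [h]
  ext i j
  simp only [mul_apply, conjTranspose_apply, Matrix.sum_apply, Fintype.sum_prod_type_right]
  simp only [Channel.dilate, of_apply, mul_apply]

/-- The dilation is a Stinespring isometry, by `∑ Kᵢ† Kᵢ = 1`. Channels therefore never change inner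
products of purifications; only queries do. -/
lemma Channel.trace_conjTranspose_dilate_mul (Φ : Channel ι κ) (Y Z : Matrix ι l ℂ) :
    ((Φ.dilate Y)ᴴ * Φ.dilate Z).trace = (Yᴴ * Z).trace := by
  have h : Yᴴ * Z = ∑ i, (Φ.kraus i * Y)ᴴ * (Φ.kraus i * Z) := by
    simp only [conjTranspose_mul, Matrix.mul_assoc]
    simp only [← Matrix.mul_sum]
    simp only [← Matrix.mul_assoc _ _ Z, ← Matrix.sum_mul, Φ.complete, Matrix.one_mul]
  rw [h, trace_sum]
  simp only [trace, diag_apply, mul_apply, conjTranspose_apply, Fintype.sum_prod_type_right]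
  simp only [Channel.dilate, of_apply, mul_apply]

lemma Channel.norm_dilate (Φ : Channel ι κ) (Z : Matrix ι l ℂ) : ‖Φ.dilate Z‖ = ‖Z‖ := by
  rw [← sq_eq_sq₀ (norm_nonneg _) (norm_nonneg _), frobenius_norm_sq, frobenius_norm_sq,
    Φ.trace_conjTranspose_dilate_mul]

lemma norm_mul_of_conjTranspose_mul_self {U : Matrix κ ι ℂ} (hU : Uᴴ * U = 1)
    (Z : Matrix ι l ℂ) : ‖U * Z‖ = ‖Z‖ := by
  rw [← sq_eq_sq₀ (norm_nonneg _) (norm_nonneg _), frobenius_norm_sq, frobenius_norm_sq,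
    conjTranspose_mul, Matrix.mul_assoc, ← Matrix.mul_assoc Uᴴ, hU, Matrix.one_mul]

/-- With `E = B† B` the probabilities are `‖B X‖²` and `‖B Y‖²`, and `B` is a contraction because `E
≤ 1`. Factor the difference of squares: the sum of the norms is at most `2`. -/
lemma trace_mul_sub_trace_mul_le {E : Matrix ι ι ℂ} (hE : E.PosSemidef) (hE' : (1 - E).PosSemidef)
    {X Y : Matrix ι l ℂ} (hX : ‖X‖ = 1) (hY : ‖Y‖ = 1) :
    (E * (X * Xᴴ)).trace.re - (E * (Y * Yᴴ)).trace.re ≤ 2 * ‖X - Y‖ := by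
  obtain ⟨B, hB⟩ := exists_eq_conjTranspose_mul_self hE
  have key : ∀ Z : Matrix ι l ℂ, (E * (Z * Zᴴ)).trace.re = ‖B * Z‖ ^ 2 := by
    intro Z
    rw [frobenius_norm_sq, conjTranspose_mul, ← Matrix.mul_assoc, trace_mul_comm, hB]
    simp only [Matrix.mul_assoc]
  have hle : ∀ Z : Matrix ι l ℂ, ‖B * Z‖ ≤ ‖Z‖ := by
    intro Z
    have h := (hE'.conjTranspose_mul_mul_same Z).trace_nonneg
    have h1 : (Zᴴ * (1 - E) * Z).trace.re = ‖Z‖ ^ 2 - ‖B * Z‖ ^ 2 := by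
      rw [frobenius_norm_sq, frobenius_norm_sq, conjTranspose_mul, hB, Matrix.mul_sub,
        Matrix.sub_mul, trace_sub, Complex.sub_re, Matrix.mul_one]
      simp only [Matrix.mul_assoc]
    have h2 := (Complex.le_def.1 h).1
    rw [h1] at h2
    exact le_of_sq_le_sq (by simpa using h2) (norm_nonneg _)
  rw [key, key]
  have h1 := hle X
  have h2 := hle Y
  have h3 := hle (X - Y)
  have h4 := norm_sub_norm_le (B * X) (B * Y)
  rw [← Matrix.mul_sub] at h4
  rw [hX] at h1
  rw [hY] at h2
  nlinarith [norm_nonneg (B * X), norm_nonneg (B * Y), norm_nonneg (X - Y)]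

open Classical in
/-- The effect of the event that the reported number lies in `S`. -/
def Measurement.event (M : Measurement ι) (S : Set ℝ) : Matrix ι ι ℂ :=
  ∑ x with M.value x ∈ S, M.effect x

lemma Measurement.prob_eq (M : Measurement ι) (σ : Matrix ι ι ℂ) (S : Set ℝ) :
    M.prob σ S = (M.event S * σ).trace.re := by
  simp only [Measurement.prob, Measurement.event, Finset.sum_mul, trace_sum, Complex.re_sum]

lemma Measurement.posSemidef_event (M : Measurement ι) (S : Set ℝ) : (M.event S).PosSemidef :=
  posSemidef_sum _ fun x _ => M.posSemidef x

lemma Measurement.one_sub_event (M : Measurement ι) (S : Set ℝ) :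
    1 - M.event S = M.event Sᶜ := by
  classical
  rw [sub_eq_iff_eq_add, ← M.complete, Measurement.event, Measurement.event, add_comm,
    ← Finset.sum_filter_add_sum_filter_not Finset.univ fun x => M.value x ∈ S]
  congr!

/-- If a measurement tells two states apart, then all their purifications are far apart. -/
lemma Measurement.norm_sub_ge (M : Measurement ι) {X Y : Matrix ι l ℂ} (hX : ‖X‖ = 1)
    (hY : ‖Y‖ = 1) {S T : Set ℝ} (hST : Disjoint S T) (hS : 2 / 3 ≤ M.prob (X * Xᴴ) S)
    (hT : 2 / 3 ≤ M.prob (Y * Yᴴ) T) : 1 / 6 ≤ ‖X - Y‖ := by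
  classical
  have h1 := M.prob_add_prob_compl (Y * Yᴴ) S
  rw [trace_mul_comm, ← frobenius_norm_sq, hY] at h1
  have h2 : M.prob (Y * Yᴴ) T ≤ M.prob (Y * Yᴴ) Sᶜ := by
    have h3 : ∀ x, 0 ≤ (M.effect x * (Y * Yᴴ)).trace.re := by
      intro x
      have h := ((M.posSemidef x).conjTranspose_mul_mul_same Y).trace_nonneg
      rw [trace_mul_comm, ← Matrix.mul_assoc, trace_mul_comm] at h
      exact (Complex.le_def.1 h).1
    refine Finset.sum_le_sum_of_subset_of_nonneg (fun x hx => ?_) fun x _ _ => h3 x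
    simp only [Finset.mem_filter, Finset.mem_univ, true_and] at hx ⊢
    exact fun hxS => Set.disjoint_left.1 hST hxS hx
  -- The probabilities of `S` differ by at least `2 / 3 - 1 / 3`, and half of this gap bounds the
  -- distance.
  have h4 := trace_mul_sub_trace_mul_le (M.posSemidef_event S)
    (M.one_sub_event S ▸ M.posSemidef_event Sᶜ) hX hY
  rw [← M.prob_eq, ← M.prob_eq] at h4
  linarith

end purification

/-! ### Two families of states that are hard to tell apart -/

section hardInstance

variable {κ : Type*} [Fintype κ] [DecidableEq κ]

/-- The unit vector `x|p⟩ + y|q⟩`. -/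
def planeVec (p q : κ) (x y : ℝ) : κ → ℂ := Pi.single p (x : ℂ) + Pi.single q (y : ℂ)

lemma star_planeVec_dotProduct {p q : κ} (hpq : p ≠ q) (x y x' y' : ℝ) :
    star (planeVec p q x y) ⬝ᵥ planeVec p q x' y' = ((x * x' + y * y' : ℝ) : ℂ) := by
  simp [planeVec, hpq, hpq.symm]

lemma nsq_planeVec {p q : κ} (hpq : p ≠ q) (x y : ℝ) :
    nsq (planeVec p q x y) = x ^ 2 + y ^ 2 := by
  have h := star_planeVec_dotProduct hpq x y x y
  rw [star_dotProduct_self] at h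
  rw [sq, sq]
  exact_mod_cast h

/-- Reflecting `|p⟩` about a line at angle `θ` doubles the angle: with `x = cos θ` and `y = sin θ`
the coordinates are `cos 2θ` and `sin 2θ`. -/
lemma reflection_planeVec_mulVec_single {p q : κ} (hpq : p ≠ q) {x y : ℝ}
    (hxy : x ^ 2 + y ^ 2 = 1) :
    reflection (planeVec p q x y) *ᵥ Pi.single p 1
      = planeVec p q (1 - 2 * y ^ 2) (2 * x * y) := by
  have h1 : (Pi.single p 1 : κ → ℂ) = planeVec p q 1 0 := by simp [planeVec]
  have h2 : x ^ 2 = 1 - y ^ 2 := by linarith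
  rw [reflection_mulVec, h1, star_planeVec_dotProduct hpq]
  have h3 : (2 * ((x * 1 + y * 0 : ℝ) : ℂ)) * (x : ℂ) - 1 = ((1 - 2 * y ^ 2 : ℝ) : ℂ) := by
    have : ((x ^ 2 : ℝ) : ℂ) = ((1 - y ^ 2 : ℝ) : ℂ) := by rw [h2]
    push_cast at this ⊢
    linear_combination 2 * this
  ext i
  simp only [planeVec, ← h3, Pi.add_apply, Pi.sub_apply, Pi.smul_apply, Pi.single_apply,
    smul_eq_mul]
  push_cast
  split_ifs <;> ring

open scoped Matrix.Norms.Frobenius in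
-- Two rank one projections of overlap `x` have squared Frobenius distance `2 - 2 x² = 2 y²`; the
-- factor `2` in a reflection contributes `4`.
lemma norm_reflection_sub_reflection_sq {p q : κ} (hpq : p ≠ q) {x y : ℝ}
    (hxy : x ^ 2 + y ^ 2 = 1) :
    ‖reflection (planeVec p q x y) - reflection (planeVec p q 1 0)‖ ^ 2 = 8 * y ^ 2 := by
  have h : reflection (planeVec p q x y) - reflection (planeVec p q 1 0)
      = (2 : ℂ) • (ketBra (planeVec p q x y) - ketBra (planeVec p q 1 0)) := by
    simp only [reflection]; module
  rw [h, norm_smul, mul_pow, frobenius_norm_sq, conjTranspose_sub, conjTranspose_ketBra,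
    conjTranspose_ketBra, Matrix.sub_mul, Matrix.mul_sub, Matrix.mul_sub, trace_sub, trace_sub,
    trace_sub]
  simp only [trace_ketBra_mul_ketBra, star_planeVec_dotProduct hpq, Complex.norm_real,
    Real.norm_eq_abs, sq_abs, Complex.sub_re, Complex.ofReal_re, Complex.norm_ofNat]
  have h2 : x ^ 2 = 1 - y ^ 2 := by linarith
  ring_nf
  rw [show x ^ 4 = (x ^ 2) ^ 2 by ring, h2]
  ring

/-- Tracing out the first factor kills the cross terms, since `x₀` and `x₁` label orthogonal states.
-/
lemma reducedState_planeVec {α β : Type*} [Fintype α] [DecidableEq α] [Fintype β] [DecidableEq β]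
    {x₀ x₁ : α} (hx : x₀ ≠ x₁) (y₀ y₁ : β) (c s : ℝ) :
    reducedState (planeVec (x₀, y₀) (x₁, y₁) c s)
      = diagonal fun b => (if b = y₀ then (c : ℂ) ^ 2 else 0) + if b = y₁ then (s : ℂ) ^ 2 else 0 := by
  ext b b'
  rw [reducedState_apply, diagonal_apply]
  simp only [planeVec, Pi.add_apply, Pi.single_apply, Prod.mk.injEq]
  rw [Finset.sum_eq_add (a := x₀) (b := x₁) hx]
  · simp only [true_and, hx, hx.symm, false_and, if_false]
    by_cases h : b = b' <;> by_cases h0 : b = y₀ <;> by_cases h1 : b = y₁ <;>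
      by_cases h0' : b' = y₀ <;> by_cases h1' : b' = y₁ <;>
      simp_all [sq]
  · intro z _ hz
    simp [hz.1, hz.2]
  · simp
  · simp

lemma powerTrace_planeVec {α β : Type*} [Fintype α] [DecidableEq α] [Fintype β] [DecidableEq β]
    {x₀ x₁ : α} (hx : x₀ ≠ x₁) {y₀ y₁ : β} (hy : y₀ ≠ y₁) (c s : ℝ) {m : ℕ} (hm : m ≠ 0) :
    powerTrace (reducedState (planeVec (x₀, y₀) (x₁, y₁) c s)) m
      = (c ^ 2) ^ m + (s ^ 2) ^ m := by
  rw [powerTrace, reducedState_planeVec hx, diagonal_pow, trace_diagonal]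
  have h : ∀ b : β, ((if b = y₀ then (c : ℂ) ^ 2 else 0) + if b = y₁ then (s : ℂ) ^ 2 else 0) ^ m
      = (if b = y₀ then (((c ^ 2) ^ m : ℝ) : ℂ) else 0)
        + if b = y₁ then (((s ^ 2) ^ m : ℝ) : ℂ) else 0 := by
    intro b
    by_cases h0 : b = y₀ <;> by_cases h1 : b = y₁ <;> simp_all
  simp only [Pi.pow_apply, h, Finset.sum_add_distrib, Finset.sum_ite_eq', Finset.mem_univ, if_true,
    Complex.add_re, Complex.ofReal_re]

/-- The larger eigenvalue is `(1 - 2 / m)² ≤ 1 - 3 / m`, whose `m`-th power is at most `exp (-3) ≤ 1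
/ 10`. The other is at most `4 / m ≤ 1 / 5`, which is where `m ≥ 20` comes from. -/
lemma hardInstance_powerTrace_le {m : ℕ} (hm : 20 ≤ m) {x y : ℝ} (hxy : x ^ 2 + y ^ 2 = 1)
    (hy : y ^ 2 = 1 / m) :
    ((1 - 2 * y ^ 2) ^ 2) ^ m + ((2 * x * y) ^ 2) ^ m ≤ 1 / 3 := by
  have hm' : (20 : ℝ) ≤ m := by exact_mod_cast hm
  have hx : x ^ 2 = 1 - 1 / m := by linarith
  have hi : 1 / (m : ℝ) ≤ 1 / 20 := by gcongr
  have hi0 : 0 < 1 / (m : ℝ) := by positivity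
  have h1 : ((1 - 2 * y ^ 2) ^ 2) ^ m ≤ 1 / 10 := by
    have ha : (1 - 2 * y ^ 2) ^ 2 ≤ 1 - 3 / (m : ℝ) := by
      rw [hy, show 3 / (m : ℝ) = 3 * (1 / m) by ring]; nlinarith
    have hb : 1 - 3 / (m : ℝ) ≤ Real.exp (-(3 / m)) := by
      have := Real.add_one_le_exp (-(3 / (m : ℝ))); linarith
    calc ((1 - 2 * y ^ 2) ^ 2) ^ m ≤ Real.exp (-(3 / m)) ^ m := by gcongr; linarith
      _ = Real.exp (-3) := by
        rw [← Real.exp_nat_mul]; congr 1; field_simp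
      _ ≤ 1 / 10 := by
        rw [Real.exp_neg, ← one_div]
        have := Real.exp_one_gt_d9
        have h3 : Real.exp 3 = Real.exp 1 ^ 3 := by rw [← Real.exp_nat_mul]; norm_num
        rw [h3]
        refine one_div_le_one_div_of_le (by norm_num) ?_
        calc (10 : ℝ) ≤ 2.7 ^ 3 := by norm_num
          _ ≤ _ := by gcongr; linarith
  have h2 : ((2 * x * y) ^ 2) ^ m ≤ 1 / 5 := by
    have ha : (2 * x * y) ^ 2 ≤ 1 / 5 := by
      rw [mul_pow, mul_pow, hx, hy]; nlinarith
    calc ((2 * x * y) ^ 2) ^ m ≤ (2 * x * y) ^ 2 := by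
          refine pow_le_of_le_one (by positivity) (by linarith) (by omega)
      _ ≤ 1 / 5 := ha
  linarith

/-- The accepted answers for the two hard instances are disjoint. -/
lemma disjoint_strictlyWithin_planeVec {α β : Type*} [Fintype α] [DecidableEq α] [Fintype β]
    [DecidableEq β] {x₀ x₁ : α} (hx : x₀ ≠ x₁) {y₀ y₁ : β} (hy : y₀ ≠ y₁) {m : ℕ} (hm : 20 ≤ m)
    {x y : ℝ} (hxy : x ^ 2 + y ^ 2 = 1) (hym : y ^ 2 = 1 / m) :
    Disjoint
      (strictlyWithin (reducedState
        (planeVec (x₀, y₀) (x₁, y₁) (1 - 2 * y ^ 2) (2 * x * y))) m (1 / 3))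
      (strictlyWithin (reducedState (planeVec (x₀, y₀) (x₁, y₁) 1 0)) m (1 / 3)) := by
  rw [Set.disjoint_left]
  intro v hv hv'
  rw [strictlyWithin_mem_iff, powerTrace_planeVec hx hy _ _ (by omega), abs_lt] at hv hv'
  -- The two power traces differ by at least `2 / 3`, twice the radius, and the balls are open.
  have h := hardInstance_powerTrace_le hm hxy hym
  have h0 : ((0 : ℝ) ^ 2) ^ m = 0 := by simp; omega
  rw [h0] at hv'
  norm_num at hv'
  linarith [hv.2, hv'.1]

lemma exists_plane_angle {m : ℕ} (hm : 1 ≤ m) :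
    ∃ x y : ℝ, x ^ 2 + y ^ 2 = 1 ∧ y ^ 2 = 1 / m := by
  have h : (1 : ℝ) / m ≤ 1 := by
    rw [div_le_one (by positivity)]; exact_mod_cast hm
  refine ⟨√(1 - 1 / m), √(1 / m), ?_, Real.sq_sqrt (by positivity)⟩
  rw [Real.sq_sqrt (by linarith), Real.sq_sqrt (by positivity)]
  ring

end hardInstance

/-! ### Lower bounds -/

section lowerBounds

open scoped Matrix.Norms.Frobenius

lemma copyOracle_mul_conjTranspose {ι κ l : Type*} [Fintype l] (ψ : κ → ℂ) (X : Matrix ι l ℂ) :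
    copyOracle ψ (X * Xᴴ) = (X ⊗ₖ replicateCol Unit ψ) * (X ⊗ₖ replicateCol Unit ψ)ᴴ := by
  rw [conjTranspose_kronecker, ← mul_kronecker_mul, copyOracle, ketBra, vecMulVec_eq Unit]
  rfl

/-- Purifications of the runs of one copy algorithm on two different states. -/
lemma CopyAlgorithm.exists_purification {a d D : ℕ}
    (steps : List (Channel (Fin D × (Fin a × Fin d)) (Fin D))) (ψ φ : Fin a × Fin d → ℂ) :
    ∀ (l : Type) [Fintype l] (X Y : Matrix (Fin D) l ℂ), ∃ (l' : Type) (_ : Fintype l')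
      (X' Y' : Matrix (Fin D) l' ℂ),
      steps.foldl (fun σ Φ => Φ.apply (copyOracle ψ σ)) (X * Xᴴ) = X' * X'ᴴ ∧
      steps.foldl (fun σ Φ => Φ.apply (copyOracle φ σ)) (Y * Yᴴ) = Y' * Y'ᴴ ∧
      (X'ᴴ * X').trace = (Xᴴ * X).trace * (star ψ ⬝ᵥ ψ) ^ steps.length ∧
      (Y'ᴴ * Y').trace = (Yᴴ * Y).trace * (star φ ⬝ᵥ φ) ^ steps.length ∧
      (X'ᴴ * Y').trace = (Xᴴ * Y).trace * (star ψ ⬝ᵥ φ) ^ steps.length := by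
  induction steps with
  | nil => exact fun l _ X Y => ⟨l, inferInstance, X, Y, rfl, rfl, by simp, by simp, by simp⟩
  | cons Φ steps ih =>
    intro l _ X Y
    obtain ⟨l', hl', X', Y', h1, h2, h3, h4, h5⟩ :=
      ih _ (Φ.dilate (X ⊗ₖ replicateCol Unit ψ)) (Φ.dilate (Y ⊗ₖ replicateCol Unit φ))
    -- Appending the copy is tensoring with a column, so a query multiplies the inner product by the
    -- overlap of the copies.
    have key : ∀ (Z W : Matrix (Fin D) l ℂ) (z w : Fin a × Fin d → ℂ),
        ((Z ⊗ₖ replicateCol Unit z)ᴴ * (W ⊗ₖ replicateCol Unit w)).trace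
          = (Zᴴ * W).trace * (star z ⬝ᵥ w) := by
      intro Z W z w
      rw [conjTranspose_kronecker, ← mul_kronecker_mul, trace_kronecker]
      simp [trace, mul_apply, dotProduct]
    simp only [Φ.dilate_mul_conjTranspose, ← copyOracle_mul_conjTranspose,
      Φ.trace_conjTranspose_dilate_mul, key] at h1 h2 h3 h4 h5
    refine ⟨l', hl', X', Y', h1, h2, ?_, ?_, ?_⟩
    · rw [h3, List.length_cons, pow_succ', mul_assoc]
    · rw [h4, List.length_cons, pow_succ', mul_assoc]
    · rw [h5, List.length_cons, pow_succ', mul_assoc]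

lemma isDensity_exists_purification {ι : Type*} [Fintype ι] {σ : Matrix ι ι ℂ}
    (h : IsDensity σ) : ∃ X : Matrix ι ι ℂ, σ = X * Xᴴ ∧ (Xᴴ * X).trace = 1 := by
  obtain ⟨B, hB⟩ := exists_eq_conjTranspose_mul_self h.posSemidef
  refine ⟨Bᴴ, by rw [hB, conjTranspose_conjTranspose], ?_⟩
  rw [trace_mul_comm, conjTranspose_conjTranspose, ← hB, h.trace_eq_one]

/-- Telling two pure states of overlap `f` apart takes at least `1 / (72 (1 - f))` copies. -/
theorem CopyAlgorithm.le_queries {a d : ℕ} (alg : CopyAlgorithm a d) {ψ φ : Fin a × Fin d → ℂ}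
    (hψ : nsq ψ = 1) (hφ : nsq φ = 1) {f : ℝ} (hf : star ψ ⬝ᵥ φ = f) (hf0 : 0 ≤ f)
    {S T : Set ℝ} (hST : Disjoint S T) (hS : 2 / 3 ≤ alg.outputProb ψ S)
    (hT : 2 / 3 ≤ alg.outputProb φ T) : 1 / 72 ≤ (1 - f) * alg.queries := by
  obtain ⟨X₀, h0, h0'⟩ := isDensity_exists_purification alg.start_isDensity
  obtain ⟨l, hl, X, Y, h1, h2, h3, h4, h5⟩ := exists_purification alg.steps ψ φ _ X₀ X₀
  rw [← h0] at h1 h2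
  rw [h0', star_dotProduct_self, hψ, Complex.ofReal_one, one_pow, one_mul] at h3
  rw [h0', star_dotProduct_self, hφ, Complex.ofReal_one, one_pow, one_mul] at h4
  rw [h0', hf, one_mul] at h5
  have hX : ‖X‖ ^ 2 = 1 := by rw [frobenius_norm_sq, h3, Complex.one_re]
  have hY : ‖Y‖ ^ 2 = 1 := by rw [frobenius_norm_sq, h4, Complex.one_re]
  have hX1 : ‖X‖ = 1 := by nlinarith [norm_nonneg X]
  have hY1 : ‖Y‖ = 1 := by nlinarith [norm_nonneg Y]
  have hd : ‖X - Y‖ ^ 2 = 2 - 2 * f ^ alg.queries := by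
    have h6 : (Yᴴ * X).trace = (f : ℂ) ^ alg.steps.length := by
      rw [← conjTranspose_conjTranspose (Yᴴ * X), conjTranspose_mul, conjTranspose_conjTranspose,
        trace_conjTranspose, h5, Complex.star_def, ← Complex.ofReal_pow, Complex.conj_ofReal]
    rw [frobenius_norm_sq, conjTranspose_sub, Matrix.sub_mul, Matrix.mul_sub, Matrix.mul_sub,
      trace_sub, trace_sub, trace_sub, h3, h4, h5, h6, ← Complex.ofReal_pow]
    simp only [Complex.sub_re, Complex.one_re, Complex.ofReal_re, queries]
    ring
  rw [outputProb, finalState, h1] at hS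
  rw [outputProb, finalState, h2] at hT
  have h7 := alg.readout.norm_sub_ge hX1 hY1 hST hS hT
  -- Bernoulli turns the squared distance `2 - 2 f ^ q` into at most `2 q (1 - f)`, to be compared
  -- with `(1 / 6)²`.
  have h8 : 1 + (alg.queries : ℝ) * (f - 1) ≤ f ^ alg.queries := by
    have := one_add_mul_le_pow (a := f - 1) (by linarith) alg.queries
    simpa using this
  nlinarith

lemma OracleCall.toMatrix_mem_unitaryGroup {a d : ℕ} (c : OracleCall) (w : ℕ)
    {U : Matrix (Fin a × Fin d) (Fin a × Fin d) ℂ} (hU : U ∈ unitaryGroup (Fin a × Fin d) ℂ) :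
    (c.toMatrix w U)ᴴ * c.toMatrix w U = 1 := by
  have h1 : Uᴴ * U = 1 := mem_unitaryGroup_iff'.1 hU
  have h2 : U * Uᴴ = 1 := mem_unitaryGroup_iff.1 hU
  have h3 : (if c.inverse then Uᴴ else U)ᴴ * (if c.inverse then Uᴴ else U) = 1 := by
    split_ifs
    · rw [conjTranspose_conjTranspose, h2]
    · exact h1
  simp only [OracleCall.toMatrix]
  set V := if c.inverse then Uᴴ else U
  split_ifs
  -- The two control projections are orthogonal and sum to one: cross terms vanish and the branches
  -- are unitary separately.
  · have hd : ∀ u v : Fin 2 → ℂ, (∀ i, star (u i) = u i) →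
        (diagonal u)ᴴ * diagonal v = diagonal fun i => u i * v i := by
      intro u v hu
      rw [diagonal_conjTranspose, diagonal_mul_diagonal]
      congr 1
      funext i
      rw [Pi.star_apply, hu]
    have hs0 : ∀ i : Fin 2, star ((![1, 0] : Fin 2 → ℂ) i) = (![1, 0] : Fin 2 → ℂ) i := by
      intro i; fin_cases i <;> simp
    have hs1 : ∀ i : Fin 2, star ((![0, 1] : Fin 2 → ℂ) i) = (![0, 1] : Fin 2 → ℂ) i := by
      intro i; fin_cases i <;> simp
    have e0 : (fun i => (![1, 0] : Fin 2 → ℂ) i * (![0, 1] : Fin 2 → ℂ) i) = 0 := by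
      funext i; fin_cases i <;> simp
    have e1 : (fun i => (![0, 1] : Fin 2 → ℂ) i * (![1, 0] : Fin 2 → ℂ) i) = 0 := by
      funext i; fin_cases i <;> simp
    have e2 : (fun i => (![1, 0] : Fin 2 → ℂ) i * (![1, 0] : Fin 2 → ℂ) i) = ![1, 0] := by
      funext i; fin_cases i <;> simp
    have e3 : (fun i => (![0, 1] : Fin 2 → ℂ) i * (![0, 1] : Fin 2 → ℂ) i) = ![0, 1] := by
      funext i; fin_cases i <;> simp
    simp only [conjTranspose_add, conjTranspose_kronecker, Matrix.add_mul, Matrix.mul_add,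
      ← mul_kronecker_mul, h3, hd _ _ hs0, hd _ _ hs1, e0, e1, e2, e3, conjTranspose_one,
      Matrix.one_mul, one_kronecker_one]
    rw [show diagonal (0 : Fin 2 → ℂ) = 0 from diagonal_zero, zero_kronecker, zero_kronecker,
      add_zero, zero_add, ← add_kronecker, diagonal_add]
    have e4 : (diagonal fun i => (![1, 0] : Fin 2 → ℂ) i + (![0, 1] : Fin 2 → ℂ) i) = 1 := by
      rw [← diagonal_one]
      congr 1
      funext i; fin_cases i <;> simp
    rw [e4, one_kronecker_one]
  · simp only [conjTranspose_kronecker, ← mul_kronecker_mul, h3, conjTranspose_one,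
      Matrix.one_mul, one_kronecker_one]

lemma frobenius_norm_sq_eq_sum {κ l : Type*} [Fintype κ] [Fintype l] (A : Matrix κ l ℂ) :
    ‖A‖ ^ 2 = ∑ i, ∑ j, ‖A i j‖ ^ 2 := by
  rw [frobenius_norm_def, ← Real.sqrt_eq_rpow, Real.sq_sqrt (by positivity)]
  simp only [Real.rpow_ofNat]

/-- Only the index in `κ` is touched by `W`. Regrouping all other indices of `X` as columns reduces
the claim to submultiplicativity of the Frobenius norm, so the spectator systems contribute no
dimension factor. -/
lemma norm_diagonal_kronecker_mul_le {ι w κ l : Type*} [Fintype ι] [DecidableEq ι] [Fintype w]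
    [DecidableEq w] [Fintype κ] [Fintype l] {r : ι → ℂ} (hr : ∀ i, ‖r i‖ ≤ 1)
    (W : Matrix κ κ ℂ) (X : Matrix (ι × w × κ) l ℂ) :
    ‖(diagonal r ⊗ₖ ((1 : Matrix w w ℂ) ⊗ₖ W)) * X‖ ≤ ‖W‖ * ‖X‖ := by
  have comm : ∀ F : κ → ι → w → l → ℝ,
      ∑ k, ∑ i, ∑ t, ∑ c, F k i t c = ∑ i, ∑ t, ∑ k, ∑ c, F k i t c := fun F => by
    rw [Finset.sum_comm]
    exact Finset.sum_congr rfl fun i _ => Finset.sum_comm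
  set Y : Matrix κ (ι × w × l) ℂ := Matrix.of fun k p => X (p.1, p.2.1, k) p.2.2 with hY
  have hXY : ‖X‖ = ‖Y‖ := by
    rw [← sq_eq_sq₀ (norm_nonneg _) (norm_nonneg _), frobenius_norm_sq_eq_sum,
      frobenius_norm_sq_eq_sum]
    simp only [Fintype.sum_prod_type, hY, of_apply]
    exact (comm fun k i t c => ‖X (i, t, k) c‖ ^ 2).symm
  have hle : ‖(diagonal r ⊗ₖ ((1 : Matrix w w ℂ) ⊗ₖ W)) * X‖ ≤ ‖W * Y‖ := by
    refine le_of_sq_le_sq ?_ (norm_nonneg _)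
    rw [frobenius_norm_sq_eq_sum, frobenius_norm_sq_eq_sum]
    have : ∀ i t k c, ((diagonal r ⊗ₖ ((1 : Matrix w w ℂ) ⊗ₖ W)) * X) (i, t, k) c
        = r i * (W * Y) k (i, t, c) := by
      intro i t k c
      simp only [mul_apply, Fintype.sum_prod_type, kroneckerMap_apply, diagonal_apply, one_apply,
        hY, of_apply, ite_mul, zero_mul, one_mul, mul_ite, mul_zero, Finset.sum_ite_irrel,
        Finset.sum_const_zero, Finset.sum_ite_eq, Finset.mem_univ, if_true, Finset.mul_sum,
        mul_assoc]
    simp only [Fintype.sum_prod_type, this]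
    rw [comm fun k i t c => ‖(W * Y) k (i, t, c)‖ ^ 2]
    refine Finset.sum_le_sum fun i _ => Finset.sum_le_sum fun t _ => Finset.sum_le_sum fun k _ =>
      Finset.sum_le_sum fun c _ => ?_
    rw [norm_mul]
    gcongr
    exact mul_le_of_le_one_left (norm_nonneg _) (hr i)
  calc _ ≤ ‖W * Y‖ := hle
    _ ≤ ‖W‖ * ‖X‖ := hXY ▸ frobenius_norm_mul W Y

lemma kronecker_sub_kronecker {ι ι' κ κ' : Type*} (A : Matrix ι ι' ℂ) (B C : Matrix κ κ' ℂ) :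
    A ⊗ₖ B - A ⊗ₖ C = A ⊗ₖ (B - C) := by
  ext i j
  simp [mul_sub]

/-- Adjoints preserve the Frobenius norm, and a controlled call differs only in the branch `|1⟩⟨1|`;
so all four kinds of call obey the same bound. -/
lemma OracleCall.norm_toMatrix_sub_mul_le {a d : ℕ} (c : OracleCall) (w : ℕ)
    (U V : Matrix (Fin a × Fin d) (Fin a × Fin d) ℂ) {l : Type*} [Fintype l]
    (X : Matrix (Register w a d) l ℂ) :
    ‖(c.toMatrix w U - c.toMatrix w V) * X‖ ≤ ‖U - V‖ * ‖X‖ := by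
  have h1 : ‖(if c.inverse then Uᴴ else U) - (if c.inverse then Vᴴ else V)‖ = ‖U - V‖ := by
    split_ifs
    · rw [← conjTranspose_sub, frobenius_norm_conjTranspose]
    · rfl
  rw [← h1]
  simp only [OracleCall.toMatrix]
  generalize (if c.inverse then Uᴴ else U) = U'
  generalize (if c.inverse then Vᴴ else V) = V'
  split_ifs
  · rw [add_sub_add_left_eq_sub, kronecker_sub_kronecker, kronecker_sub_kronecker]
    refine norm_diagonal_kronecker_mul_le (fun i => ?_) _ X
    fin_cases i <;> simp
  · rw [kronecker_sub_kronecker, kronecker_sub_kronecker, ← diagonal_one (n := Fin 2)]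
    exact norm_diagonal_kronecker_mul_le (fun i => by simp) _ X

/-- Purifications of the runs of one algorithm on two oracles drift apart slowly. -/
lemma UnitaryAlgorithm.exists_purification {a d D : ℕ}
    (steps : List (OracleCall × Channel (Register D a d) (Register D a d)))
    {U V : Matrix (Fin a × Fin d) (Fin a × Fin d) ℂ} (hU : U ∈ unitaryGroup (Fin a × Fin d) ℂ)
    (hV : V ∈ unitaryGroup (Fin a × Fin d) ℂ) :
    ∀ (l : Type) [Fintype l] (X Y : Matrix (Register D a d) l ℂ), ∃ (l' : Type) (_ : Fintype l')
      (X' Y' : Matrix (Register D a d) l' ℂ),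
      steps.foldl (fun σ s => s.2.apply (s.1.toMatrix D U * σ * (s.1.toMatrix D U)ᴴ)) (X * Xᴴ)
        = X' * X'ᴴ ∧
      steps.foldl (fun σ s => s.2.apply (s.1.toMatrix D V * σ * (s.1.toMatrix D V)ᴴ)) (Y * Yᴴ)
        = Y' * Y'ᴴ ∧
      ‖X'‖ = ‖X‖ ∧ ‖Y'‖ = ‖Y‖ ∧ ‖X' - Y'‖ ≤ ‖X - Y‖ + steps.length * (‖U - V‖ * ‖Y‖) := by
  induction steps with
  | nil => exact fun l _ X Y => ⟨l, inferInstance, X, Y, rfl, rfl, rfl, rfl, by simp⟩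
  | cons s steps ih =>
    intro l _ X Y
    obtain ⟨l', hl', X', Y', h1, h2, h3, h4, h5⟩ :=
      ih _ (s.2.dilate (s.1.toMatrix D U * X)) (s.2.dilate (s.1.toMatrix D V * Y))
    have key : ∀ (A : Matrix (Register D a d) (Register D a d) ℂ)
        (Z : Matrix (Register D a d) l ℂ), s.2.dilate (A * Z) * (s.2.dilate (A * Z))ᴴ
          = s.2.apply (A * (Z * Zᴴ) * Aᴴ) := by
      intro A Z
      rw [s.2.dilate_mul_conjTranspose, conjTranspose_mul]
      simp only [Matrix.mul_assoc]
    have hU1 := norm_mul_of_conjTranspose_mul_self (s.1.toMatrix_mem_unitaryGroup D hU)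
      (l := l)
    have hV1 := norm_mul_of_conjTranspose_mul_self (s.1.toMatrix_mem_unitaryGroup D hV)
      (l := l)
    rw [key] at h1 h2
    rw [s.2.norm_dilate, hU1] at h3
    rw [s.2.norm_dilate, hV1] at h4
    rw [← s.2.dilate_sub, s.2.norm_dilate, s.2.norm_dilate, hV1] at h5
    refine ⟨l', hl', X', Y', h1, h2, h3, h4, h5.trans ?_⟩
    -- Hybrid step: the old distance is carried isometrically by `U`, and the exchange of oracles
    -- acts only on `Y`.
    have h6 : s.1.toMatrix D U * X - s.1.toMatrix D V * Y
        = s.1.toMatrix D U * (X - Y) + (s.1.toMatrix D U - s.1.toMatrix D V) * Y := by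
      rw [Matrix.mul_sub, Matrix.sub_mul]; abel
    have h7 := norm_add_le (s.1.toMatrix D U * (X - Y))
      ((s.1.toMatrix D U - s.1.toMatrix D V) * Y)
    rw [← h6, hU1] at h7
    have h8 := s.1.norm_toMatrix_sub_mul_le D U V Y
    rw [List.length_cons]
    push_cast
    linarith

/-- Telling two unitary oracles apart takes at least `1 / (6 ‖U - V‖)` queries. -/
theorem UnitaryAlgorithm.le_queries {a d : ℕ} (alg : UnitaryAlgorithm a d)
    {U V : Matrix (Fin a × Fin d) (Fin a × Fin d) ℂ} (hU : U ∈ unitaryGroup (Fin a × Fin d) ℂ)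
    (hV : V ∈ unitaryGroup (Fin a × Fin d) ℂ) {S T : Set ℝ} (hST : Disjoint S T)
    (hS : 2 / 3 ≤ alg.outputProb U S) (hT : 2 / 3 ≤ alg.outputProb V T) :
    1 / 6 ≤ alg.queries * ‖U - V‖ := by
  obtain ⟨X₀, h0, h0'⟩ := isDensity_exists_purification alg.start_isDensity
  have hX₀ : ‖X₀‖ = 1 := norm_eq_one_of_isDensity (h0 ▸ alg.start_isDensity)
  obtain ⟨l, hl, X, Y, h1, h2, h3, h4, h5⟩ := exists_purification alg.steps hU hV _ X₀ X₀
  rw [← h0] at h1 h2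
  rw [outputProb, finalState, h1] at hS
  rw [outputProb, finalState, h2] at hT
  have h7 := alg.readout.norm_sub_ge (h3.trans hX₀) (h4.trans hX₀) hST hS hT
  rw [sub_self, norm_zero, zero_add, hX₀, mul_one] at h5
  exact h7.trans h5

lemma copyAlgorithm_lower_bound {a d m : ℕ} (ha : 2 ≤ a) (hd : 2 ≤ d) (hm : 20 ≤ m)
    (alg : CopyAlgorithm a d)
    (h : ∀ ψ : Fin a × Fin d → ℂ, IsUnitVector ψ →
      2 / 3 ≤ alg.outputProb ψ (strictlyWithin (reducedState ψ) m (1 / 3))) :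
    1 / 144 * (m : ℝ) ≤ alg.queries := by
  obtain ⟨x, y, hxy, hy⟩ := exists_plane_angle (m := m) (by omega)
  have hx01 : (⟨0, by omega⟩ : Fin a) ≠ ⟨1, by omega⟩ := by simp
  have hy01 : (⟨0, by omega⟩ : Fin d) ≠ ⟨1, by omega⟩ := by simp
  have hpq : ((⟨0, by omega⟩ : Fin a), (⟨0, by omega⟩ : Fin d))
      ≠ (⟨1, by omega⟩, ⟨1, by omega⟩) := fun hc => hx01 (Prod.ext_iff.1 hc).1
  have hu1 : (1 - 2 * y ^ 2) ^ 2 + (2 * x * y) ^ 2 = 1 := by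
    have : x ^ 2 = 1 - y ^ 2 := by linarith
    rw [mul_pow, mul_pow, this]; ring
  have hn1 := nsq_planeVec hpq (1 - 2 * y ^ 2) (2 * x * y)
  have hn0 := nsq_planeVec hpq 1 0
  rw [hu1] at hn1
  norm_num at hn0
  have hov := star_planeVec_dotProduct hpq (1 - 2 * y ^ 2) (2 * x * y) 1 0
  have hm' : (20 : ℝ) ≤ m := by exact_mod_cast hm
  have hi : 1 / (m : ℝ) ≤ 1 / 20 := by gcongr
  have hq := alg.le_queries hn1 hn0 hov (by rw [hy]; linarith)
    (disjoint_strictlyWithin_planeVec hx01 hy01 hm hxy hy)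
    (h _ ((isUnitVector_iff _).2 hn1)) (h _ ((isUnitVector_iff _).2 hn0))
  -- One query costs `2 / m` of overlap, whence the constant `144 = 72 · 2`.
  have h9 : 1 - ((1 - 2 * y ^ 2) * 1 + 2 * x * y * 0) = 2 / m := by rw [hy]; ring
  rw [h9, div_mul_eq_mul_div, le_div_iff₀ (by positivity)] at hq
  linarith

lemma unitaryAlgorithm_lower_bound {a d m : ℕ} [NeZero a] [NeZero d] (ha : 2 ≤ a) (hd : 2 ≤ d)
    (hm : 20 ≤ m) (alg : UnitaryAlgorithm a d)
    (h : ∀ U ∈ unitaryGroup (Fin a × Fin d) ℂ,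
      2 / 3 ≤ alg.outputProb U
        (strictlyWithin (reducedState (preparedState U)) m (1 / 3))) :
    1 / 18 * √(m : ℝ) ≤ alg.queries := by
  obtain ⟨x, y, hxy, hy⟩ := exists_plane_angle (m := m) (by omega)
  have hx01 : (0 : Fin a) ≠ ⟨1, by omega⟩ := by simp [Fin.ext_iff]
  have hy01 : (0 : Fin d) ≠ ⟨1, by omega⟩ := by simp [Fin.ext_iff]
  have hpq : ((0 : Fin a), (0 : Fin d))
      ≠ (⟨1, by omega⟩, ⟨1, by omega⟩) := fun hc => hx01 (Prod.ext_iff.1 hc).1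
  have hU := reflection_mem_unitaryGroup ((nsq_planeVec hpq x y).trans hxy)
  have hV := reflection_mem_unitaryGroup ((nsq_planeVec hpq 1 0).trans (by norm_num))
  have hS := h _ hU
  have hT := h _ hV
  have hpU := reflection_planeVec_mulVec_single hpq hxy
  have hpV := reflection_planeVec_mulVec_single hpq (x := 1) (y := 0) (by norm_num)
  rw [show 1 - 2 * (0 : ℝ) ^ 2 = 1 by norm_num, show 2 * (1 : ℝ) * 0 = 0 by norm_num] at hpV
  rw [preparedState, hpU] at hS
  rw [preparedState, hpV] at hT
  have hq := alg.le_queries hU hV (disjoint_strictlyWithin_planeVec hx01 hy01 hm hxy hy) hS hT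
  have hn := norm_reflection_sub_reflection_sq hpq hxy
  set δ := ‖reflection (planeVec ((0 : Fin a), (0 : Fin d)) (⟨1, by omega⟩, ⟨1, by omega⟩) x y)
    - reflection (planeVec (0, 0) (⟨1, by omega⟩, ⟨1, by omega⟩) 1 0)‖
  have hm0 : (0 : ℝ) < m := by exact_mod_cast (by omega : 0 < m)
  -- Here `δ² = 8 / m`, and `√8` is rounded up to `3`; with the `1 / 6` of `le_queries` this gives
  -- `1 / 18`.
  have h1 : δ * √(m : ℝ) ≤ 3 := by
    refine le_of_sq_le_sq ?_ (by norm_num)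
    rw [mul_pow, hn, Real.sq_sqrt hm0.le, hy]
    field_simp
    norm_num
  have h2 : (1 / 6) * √(m : ℝ) ≤ alg.queries * (δ * √(m : ℝ)) := by
    rw [← mul_assoc]; gcongr
  have h3 : (alg.queries : ℝ) * (δ * √(m : ℝ)) ≤ alg.queries * 3 := by gcongr
  linarith

end lowerBounds

/-! ### Reindexing -/

section reindex

variable {ι ι' κ κ' : Type*} [Fintype ι] [Fintype ι']

lemma submatrix_mulVec_comp (A : Matrix κ ι ℂ) (f : κ' → κ) (e : ι' ≃ ι) (v : ι → ℂ) :
    A.submatrix f e *ᵥ (v ∘ e) = (A *ᵥ v) ∘ f := by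
  rw [submatrix_mulVec_equiv, Function.comp_assoc, Equiv.self_comp_symm, Function.comp_id]

lemma nsq_submatrix_mulVec_sub (A : Matrix ι ι ℂ) (e : ι' ≃ ι) (v : ι → ℂ) (c : ℂ) :
    nsq (A.submatrix e e *ᵥ (v ∘ e) - c • (v ∘ e)) = nsq (A *ᵥ v - c • v) := by
  rw [submatrix_mulVec_comp, ← nsq_comp_equiv e (A *ᵥ v - c • v)]
  rfl

variable [DecidableEq ι] [DecidableEq ι'] [Fintype κ] [Fintype κ']

lemma submatrix_mem_unitaryGroup {U : Matrix ι ι ℂ} (hU : U ∈ unitaryGroup ι ℂ) (e : ι' ≃ ι) :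
    U.submatrix e e ∈ unitaryGroup ι' ℂ := by
  rw [mem_unitaryGroup_iff, star_eq_conjTranspose, conjTranspose_submatrix, submatrix_mul_equiv,
    ← star_eq_conjTranspose, mem_unitaryGroup_iff.1 hU, submatrix_one_equiv]

/-- A channel in other bases. -/
def Channel.reindex (Φ : Channel ι κ) (e : ι' ≃ ι) (f : κ' ≃ κ) : Channel ι' κ' where
  num := Φ.num
  kraus x := (Φ.kraus x).submatrix f e
  complete := by
    have h := congrArg (fun M => M.submatrix e e) Φ.complete
    simp only [submatrix_one_equiv] at h
    rw [← h]
    ext i j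
    simp only [conjTranspose_submatrix, submatrix_mul_equiv, Matrix.sum_apply, submatrix_apply]

lemma Channel.reindex_apply (Φ : Channel ι κ) (e : ι' ≃ ι) (f : κ' ≃ κ)
    (σ : Matrix ι ι ℂ) :
    (Φ.reindex e f).apply (σ.submatrix e e) = (Φ.apply σ).submatrix f f := by
  ext i j
  simp only [Channel.apply, Channel.reindex, Matrix.sum_apply, submatrix_apply,
    conjTranspose_submatrix, submatrix_mul_equiv]
  rfl

/-- The channel `σ ↦ U σ U†`. -/
def Channel.ofUnitary {U : Matrix ι ι ℂ} (hU : U ∈ unitaryGroup ι ℂ) : Channel ι ι where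
  num := 1
  kraus _ := U
  complete := by simpa [star_eq_conjTranspose] using mem_unitaryGroup_iff'.1 hU

lemma Channel.ofUnitary_apply_ketBra {U : Matrix ι ι ℂ} (hU : U ∈ unitaryGroup ι ℂ) (v : ι → ℂ) :
    (Channel.ofUnitary hU).apply (ketBra v) = ketBra (U *ᵥ v) := by
  change ∑ _ : Fin 1, U * ketBra v * Uᴴ = _
  rw [Fin.sum_univ_one, mul_ketBra_mul]

end reindex

/-! ### Storing copies -/

section store

variable {I κ : Type*}

lemma copyOracle_ketBra {ι : Type*} (ψ : κ → ℂ) (v : ι → ℂ) :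
    copyOracle ψ (ketBra v) = ketBra fun p => v p.1 * ψ p.2 := by
  ext p q
  simp [copyOracle, ketBra, vecMulVec_apply, mul_mul_mul_comm]

variable [Fintype I] [DecidableEq I]

lemma piVec_update (f : I → κ → ℂ) (i : I) (a : κ → ℂ) (w : I → κ) :
    piVec (Function.update f i a) w = a (w i) * ∏ j ∈ Finset.univ.erase i, f j (w j) := by
  rw [piVec, ← Finset.mul_prod_erase _ _ (Finset.mem_univ i), Function.update_self]
  congr 1
  exact Finset.prod_congr rfl fun j hj => by
    rw [Function.update_of_ne (Finset.ne_of_mem_erase hj)]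

variable [Fintype κ] [DecidableEq κ]

/-- The operator that puts a new system into slot `i` if the slot was in the state `x`. -/
def storeKraus (i : I) (x : κ) : Matrix (I → κ) ((I → κ) × κ) ℂ :=
  Matrix.of fun w' p => if p.1 i = x ∧ Function.update p.1 i p.2 = w' then 1 else 0

/-- The channel that replaces the system in slot `i` by a new one. -/
def storeChannel (i : I) : Channel ((I → κ) × κ) (I → κ) where
  num := Fintype.card κ
  kraus x := storeKraus i ((Fintype.equivFin κ).symm x)
  complete := by
    rw [(Fintype.equivFin κ).symm.sum_comp fun x => (storeKraus i x)ᴴ * storeKraus i x]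
    ext ⟨w, k⟩ ⟨w', k'⟩
    simp only [Matrix.sum_apply, mul_apply, conjTranspose_apply, storeKraus, of_apply, ite_and,
      apply_ite star, star_one, star_zero, ite_mul, one_mul, zero_mul, Finset.sum_ite_irrel,
      Finset.sum_const_zero, Finset.sum_ite_eq, Finset.mem_univ, if_true, one_apply]
    by_cases h : w i = w' i
    · have h1 : (Function.update w' i k' = Function.update w i k) ↔ (w, k) = (w', k') := by
        constructor
        · intro h2
          have hk : k' = k := by simpa using congrFun h2 i
          have hw : w = w' := by
            funext j
            by_cases hj : j = i
            · rw [hj, h]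
            · simpa [hj] using (congrFun h2 j).symm
          rw [hk, hw]
        · intro h2
          obtain ⟨rfl, rfl⟩ := Prod.ext_iff.1 h2
          rfl
      simp [h, h1]
    · have h1 : (w, k) ≠ (w', k') := fun h2 => h (congrFun (congrArg Prod.fst h2) i)
      simp [h1, Ne.symm h]

/-- Discarding the old content of the slot in the outcome `x` leaves its amplitude `f i x` as a
scalar. The resulting direction does not depend on `x`, so the sum over outcomes stays pure. -/
lemma storeKraus_mulVec (f : I → κ → ℂ) (i : I) (x : κ) (ψ : κ → ℂ) :
    (storeKraus i x *ᵥ fun p => piVec f p.1 * ψ p.2)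
      = f i x • piVec (Function.update f i ψ) := by
  ext w'
  -- Only one input leads to `w'`: slot `i` held `x` and the new system was in `w' i`.
  rw [mulVec, dotProduct, Finset.sum_eq_single (Function.update w' i x, w' i)]
  · have h : piVec f (Function.update w' i x)
        = f i x * ∏ j ∈ Finset.univ.erase i, f j (w' j) := by
      rw [piVec, ← Finset.mul_prod_erase _ _ (Finset.mem_univ i), Function.update_self]
      congr 1
      exact Finset.prod_congr rfl fun j hj => by
        rw [Function.update_of_ne (Finset.ne_of_mem_erase hj)]
    simp only [storeKraus, of_apply, Function.update_self, Function.update_idem,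
      Function.update_eq_self, and_self, if_true, one_mul, h, Pi.smul_apply, smul_eq_mul,
      piVec_update]
    ring
  · rintro ⟨w, k⟩ _ hne
    have : ¬(w i = x ∧ Function.update w i k = w') := by
      rintro ⟨rfl, rfl⟩
      exact hne (by simp)
    simp [storeKraus, this]
  · simp

lemma storeChannel_apply (f : I → κ → ℂ) (i : I) (hi : nsq (f i) = 1) (ψ : κ → ℂ) :
    (storeChannel i).apply (copyOracle ψ (ketBra (piVec f)))
      = ketBra (piVec (Function.update f i ψ)) := by
  rw [copyOracle_ketBra, Channel.apply]
  simp only [mul_ketBra_mul]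
  have h : ∀ x, ketBra ((storeChannel (κ := κ) i).kraus x *ᵥ fun p => piVec f p.1 * ψ p.2)
      = (fun y => ((‖f i y‖ ^ 2 : ℝ) : ℂ) • ketBra (piVec (Function.update f i ψ)))
        ((Fintype.equivFin κ).symm x) := by
    intro x
    rw [show (storeChannel i).kraus x = storeKraus i ((Fintype.equivFin κ).symm x) from rfl,
      storeKraus_mulVec]
    simp only [ketBra, star_smul, smul_vecMulVec, vecMulVec_smul, smul_smul,
      ← star_mul_self_eq_norm_sq]
  rw [Finset.sum_congr rfl fun x _ => h x]
  refine ((Fintype.equivFin κ).symm.sum_comp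
    fun y => ((‖f i y‖ ^ 2 : ℝ) : ℂ) • ketBra (piVec (Function.update f i ψ))).trans ?_
  rw [← Finset.sum_smul, ← Complex.ofReal_sum, show ∑ y, ‖f i y‖ ^ 2 = nsq (f i) from rfl, hi,
    Complex.ofReal_one, one_smul]

lemma foldl_storeChannel (l : List I) {ψ : κ → ℂ} (hψ : nsq ψ = 1) (f : I → κ → ℂ)
    (hf : ∀ i, nsq (f i) = 1) :
    l.foldl (fun σ i => (storeChannel i).apply (copyOracle ψ σ)) (ketBra (piVec f))
      = ketBra (piVec fun i => if i ∈ l then ψ else f i) := by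
  induction l generalizing f with
  | nil => simp
  | cons i l ih =>
    rw [List.foldl_cons, storeChannel_apply f i (hf i), ih]
    · congr 2
      funext j
      by_cases hj : j = i
      · subst hj; simp
      · simp [hj]
    · intro j
      by_cases hj : j = i
      · subst hj; simpa using hψ
      · simpa [hj] using hf j

end store

/-! ### Copy algorithms that measure an observable -/

lemma nsq_single {κ : Type*} [Fintype κ] [DecidableEq κ] (x : κ) :
    nsq (Pi.single x (1 : ℂ)) = 1 := by
  have : ∀ i, ‖(Pi.single x (1 : ℂ) : κ → ℂ) i‖ ^ 2 = if i = x then 1 else 0 := by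
    intro i
    by_cases h : i = x
    · subst h; simp
    · simp [h]
  simp only [nsq, this, Finset.sum_ite_eq', Finset.mem_univ, if_true]

/-- A copy algorithm that reports the constant `c` without any query. -/
lemma CopyAlgorithm.exists_const (a d : ℕ) (c : ℝ) :
    ∃ alg : CopyAlgorithm a d, alg.queries = 0 ∧ ∀ ψ S, c ∈ S → alg.outputProb ψ S = 1 := by
  refine ⟨⟨1, 1, ⟨PosSemidef.one, by simp⟩, [], ⟨1, fun _ => 1, fun _ => PosSemidef.one, by simp,
    fun _ => c⟩⟩, rfl, fun ψ S hS => ?_⟩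
  simp [outputProb, finalState, Measurement.prob, hS]

/-- Any observable can be measured on `I` copies of the state, with one query for each. -/
lemma CopyAlgorithm.exists_measure {I : Type*} [Fintype I] [DecidableEq I] {a d : ℕ}
    [Nonempty (Fin a × Fin d)] {A : Matrix (I → Fin a × Fin d) (I → Fin a × Fin d) ℂ}
    (hA : A.IsHermitian) : ∃ alg : CopyAlgorithm a d, alg.queries = Fintype.card I ∧
      ∀ (ψ : Fin a × Fin d → ℂ), nsq ψ = 1 → ∀ (μ ε : ℝ) (S : Set ℝ), 0 < ε →
        nsq (A *ᵥ piVec (fun _ => ψ) - (μ : ℂ) • piVec fun _ => ψ) < ε ^ 2 / 3 →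
        (∀ x, |x - μ| ≤ ε → x ∈ S) → 2 / 3 < alg.outputProb ψ S := by
  obtain ⟨k₀⟩ := ‹Nonempty (Fin a × Fin d)›
  let e : Fin (Fintype.card (I → Fin a × Fin d)) ≃ (I → Fin a × Fin d) := (Fintype.equivFin _).symm
  let e' := e.prodCongr (Equiv.refl (Fin a × Fin d))
  let f₀ : I → Fin a × Fin d → ℂ := fun _ => Pi.single k₀ 1
  have hAe := hA.submatrix e
  have hf₀ : ∀ i, nsq (f₀ i) = 1 := fun i => nsq_single k₀
  have hv : nsq (piVec f₀) = 1 := by rw [nsq_piVec]; simp [hf₀]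
  refine ⟨⟨_, ketBra (piVec f₀ ∘ e),
    isDensity_ketBra (by rw [nsq_comp_equiv, hv]),
    Finset.univ.toList.map fun i : I => (storeChannel i).reindex e' e,
    spectralMeasurement hAe⟩, by simp [queries], fun ψ hψ μ ε S hε h hS => ?_⟩
  have hfold : ∀ (l : List I) (σ : Matrix (I → Fin a × Fin d) (I → Fin a × Fin d) ℂ),
      l.foldl (fun σ i => ((storeChannel i).reindex e' e).apply (copyOracle ψ σ)) (σ.submatrix e e)
        = (l.foldl (fun σ i => (storeChannel i).apply (copyOracle ψ σ)) σ).submatrix e e := by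
    intro l
    induction l with
    | nil => exact fun _ => rfl
    | cons i l ih =>
      intro σ
      rw [List.foldl_cons, List.foldl_cons, ← ih, ← Channel.reindex_apply _ e' e]
      rfl
  have hpsi : nsq (piVec fun _ : I => ψ) = 1 := by rw [nsq_piVec]; simp [hψ]
  have hstate : (Finset.univ.toList.map fun i : I => (storeChannel i).reindex e' e).foldl
      (fun σ Φ => Φ.apply (copyOracle ψ σ)) (ketBra (piVec f₀ ∘ e))
        = ketBra (piVec (fun _ => ψ) ∘ e) := by
    rw [List.foldl_map, ketBra_comp, hfold, foldl_storeChannel _ hψ _ hf₀]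
    simp only [Finset.mem_toList, Finset.mem_univ, if_true]
    rfl
  refine lt_of_lt_of_eq (lt_spectralMeasurement_prob hAe (μ := μ) (by rw [nsq_comp_equiv, hpsi])
    hε ?_ hS) (congrArg (fun σ => (spectralMeasurement hAe).prob σ S) hstate.symm)
  rwa [nsq_submatrix_mulVec_sub]

/-! ### Averaging an observable over independent blocks -/

section average

variable {X : Type*} [Fintype X] [DecidableEq X]

/-- The average of the observable `H` over `k` blocks. -/
def blockAverage (k : ℕ) (H : Matrix X X ℂ) : Matrix (Fin k → X) (Fin k → X) ℂ :=
  (k : ℂ)⁻¹ • ∑ j, piTensor (Fin k) X (Pi.mulSingle j H)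

lemma isHermitian_blockAverage (k : ℕ) {H : Matrix X X ℂ} (hH : H.IsHermitian) :
    (blockAverage k H).IsHermitian := by
  have h : ∀ j : Fin k, (fun i => ((Pi.mulSingle j H : Fin k → Matrix X X ℂ) i)ᴴ)
      = Pi.mulSingle j H := by
    intro j
    funext i
    by_cases hi : i = j
    · subst hi; simpa using hH.eq
    · simp [hi]
  rw [IsHermitian, blockAverage, conjTranspose_smul, conjTranspose_sum]
  simp only [conjTranspose_piTensor, h]
  simp

/-- Variances of independent blocks add. The deviation `h = (H - μ) φ` is orthogonal to `φ`, so the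
vectors with `h` in one block and `φ` elsewhere are pairwise orthogonal; the average has squared
norm `k ‖h‖² / k²`. -/
lemma nsq_blockAverage_mulVec_sub_le {k : ℕ} (hk : k ≠ 0) {H : Matrix X X ℂ} (hH : H.IsHermitian)
    {φ : X → ℂ} (hφ : nsq φ = 1) (hHφ : nsq (H *ᵥ φ) ≤ 1) {μ : ℝ}
    (hμ : star φ ⬝ᵥ (H *ᵥ φ) = μ) :
    nsq (blockAverage k H *ᵥ piVec (fun _ => φ) - (μ : ℂ) • piVec fun _ => φ) ≤ 1 / k := by
  set h := H *ᵥ φ - (μ : ℂ) • φ with hh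
  set v : Fin k → (Fin k → X) → ℂ := fun j => piVec (Function.update (fun _ => φ) j h) with hv
  have hk' : (k : ℂ) ≠ 0 := by exact_mod_cast hk
  have hsum : blockAverage k H *ᵥ piVec (fun _ => φ) - (μ : ℂ) • piVec (fun _ => φ)
      = (k : ℂ)⁻¹ • ∑ j, v j := by
    have h1 : ∀ j, piTensor (Fin k) X (Pi.mulSingle j H) *ᵥ piVec (fun _ => φ)
        = v j + (μ : ℂ) • piVec fun _ => φ := by
      intro j
      rw [piTensor_mulVec_piVec]
      have h2 : (fun i => (Pi.mulSingle j H : Fin k → Matrix X X ℂ) i *ᵥ φ)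
          = Function.update (fun _ => φ) j (H *ᵥ φ) := by
        funext i
        by_cases hi : i = j
        · subst hi; simp
        · simp [hi]
      rw [h2]
      ext w
      have h3 := piVec_update (fun _ : Fin k => φ) j φ w
      rw [Function.update_eq_self] at h3
      simp only [hv, Pi.add_apply, Pi.smul_apply, smul_eq_mul, h3, piVec_update, hh, Pi.sub_apply]
      ring
    rw [blockAverage, smul_mulVec, sum_mulVec, Finset.sum_congr rfl fun j _ => h1 j,
      Finset.sum_add_distrib, smul_add, Finset.sum_const, Finset.card_univ, Fintype.card_fin,
      ← Nat.cast_smul_eq_nsmul ℂ, smul_smul (k : ℂ)⁻¹, inv_mul_cancel₀ hk', one_smul,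
      add_sub_cancel_right]
  have hφh : star φ ⬝ᵥ h = 0 := by
    rw [hh, dotProduct_sub, hμ, dotProduct_smul, star_dotProduct_self, hφ]
    simp
  have horth : ∀ i j, i ≠ j → star (v i) ⬝ᵥ v j = 0 := by
    intro i j hij
    rw [hv, star_piVec_dotProduct_piVec]
    refine Finset.prod_eq_zero (Finset.mem_univ j) ?_
    rw [Function.update_self, Function.update_of_ne hij.symm, hφh]
  have hself : ∀ i, star (v i) ⬝ᵥ v i = (nsq h : ℂ) := by
    intro i
    rw [star_dotProduct_self, hv, nsq_piVec, ← Finset.mul_prod_erase _ _ (Finset.mem_univ i),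
      Function.update_self, Finset.prod_eq_one, mul_one]
    intro j hj
    rw [Function.update_of_ne (Finset.ne_of_mem_erase hj), hφ]
  have htot : nsq (∑ j, v j) = k * nsq h := by
    have : (nsq (∑ j, v j) : ℂ) = ((k * nsq h : ℝ) : ℂ) := by
      rw [← star_dotProduct_self, star_sum, sum_dotProduct]
      simp only [dotProduct_sum]
      rw [Finset.sum_congr rfl fun i _ =>
        (Finset.sum_eq_single i (fun j _ hj => horth i j hj.symm) (by simp)).trans (hself i)]
      simp
    exact_mod_cast this
  have hle : nsq h ≤ 1 := by
    rw [hh, nsq_mulVec_sub_smul hH hφ hμ]; nlinarith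
  rw [hsum, nsq_smul, htot, norm_inv, Complex.norm_natCast]
  have hk0 : (0 : ℝ) < k := by positivity
  field_simp
  exact hle

end average

/-! ### The observable with mean `Tr (ρ ^ m)` -/

section observable

variable {α β : Type*} [DecidableEq α] [DecidableEq β]

/-- The Hermitian part of the cyclic permutation of the second components of `m` registers. -/
def cyclicObservable (α β : Type*) [DecidableEq α] [DecidableEq β] (m : ℕ) :
    Matrix (Fin m → α × β) (Fin m → α × β) ℂ :=
  (1 / 2 : ℂ) • (Equiv.Perm.permMatrix ℂ (permuteB (finRotate m))
    + Equiv.Perm.permMatrix ℂ (permuteB (finRotate m)).symm)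

lemma isHermitian_cyclicObservable (m : ℕ) : (cyclicObservable α β m).IsHermitian := by
  rw [IsHermitian, cyclicObservable, conjTranspose_smul, conjTranspose_add,
    conjTranspose_permMatrix, conjTranspose_permMatrix, add_comm]
  simp [Equiv.Perm.inv_def]

variable [Fintype α] [Fintype β]

lemma cyclicObservable_mulVec (m : ℕ) (v : (Fin m → α × β) → ℂ) :
    cyclicObservable α β m *ᵥ v = (1 / 2 : ℂ) • (((1 : ℝ) : ℂ) • (v ∘ permuteB (finRotate m))
      + ((1 : ℝ) : ℂ) • (v ∘ (permuteB (finRotate m)).symm)) := by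
  rw [cyclicObservable, smul_mulVec, add_mulVec, permMatrix_mulVec, permMatrix_mulVec]
  simp

lemma nsq_cyclicObservable_mulVec_le (m : ℕ) {v : (Fin m → α × β) → ℂ} (hv : nsq v = 1) :
    nsq (cyclicObservable α β m *ᵥ v) ≤ 1 := by
  rw [cyclicObservable_mulVec]
  refine (nsq_half_smul_add_le 1 1 _ _).trans ?_
  rw [nsq_comp_equiv, nsq_comp_equiv, hv]
  norm_num

lemma star_dotProduct_cyclicObservable_mulVec (ψ : α × β → ℂ) {m : ℕ} (hm : m ≠ 0) :
    star (piVec fun _ : Fin m => ψ) ⬝ᵥ (cyclicObservable α β m *ᵥ piVec fun _ => ψ)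
      = powerTrace (reducedState ψ) m := by
  rw [cyclicObservable_mulVec, dotProduct_smul, dotProduct_add, dotProduct_smul, dotProduct_smul,
    star_piVec_dotProduct_comp_permuteB_finRotate ψ hm,
    star_piVec_dotProduct_comp_permuteB_finRotate_symm ψ hm]
  simp
  ring

/-- Nonnegativity of the variance of the cyclic observable, whose second moment is at most one. -/
lemma abs_powerTrace_le_one {ψ : α × β → ℂ} (hψ : nsq ψ = 1) {m : ℕ} (hm : m ≠ 0) :
    |powerTrace (reducedState ψ) m| ≤ 1 := by
  have hv : nsq (piVec fun _ : Fin m => ψ) = 1 := by rw [nsq_piVec]; simp [hψ]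
  have h1 := nsq_mulVec_sub_smul (isHermitian_cyclicObservable m) hv
    (star_dotProduct_cyclicObservable_mulVec ψ hm)
  have h2 := nsq_nonneg (cyclicObservable α β m *ᵥ piVec (fun _ => ψ)
    - (powerTrace (reducedState ψ) m : ℂ) • piVec fun _ => ψ)
  have h3 := nsq_cyclicObservable_mulVec_le m hv
  exact abs_le_one_iff_mul_self_le_one.2 (by nlinarith)

/-- The constant answer that is within `ε` of `Tr (ρ ^ m)` when `m = 0` or `ε ≥ 1`. -/
lemma trivial_answer_mem_within (m : ℕ) (ε : ℝ) (hε : 0 < ε) (h : m = 0 ∨ 1 ≤ ε)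
    {ψ : α × β → ℂ} (hψ : nsq ψ = 1) :
    (if m = 0 then (Fintype.card β : ℝ) else 0) ∈ within (reducedState ψ) m ε := by
  rw [within_mem_iff]
  by_cases hm : m = 0
  · subst hm
    simp [powerTrace, hε.le]
  · rw [if_neg hm, zero_sub, abs_neg]
    exact (abs_powerTrace_le_one hψ hm).trans (h.resolve_left hm)

end observable

/-! ### Upper bound for the copy-producing oracle -/

theorem copyAlgorithm_upper_bound (a d m : ℕ) (ε : ℝ) (hε : 0 < ε) :
    ∃ alg : CopyAlgorithm a d, (alg.queries : ℝ) ≤ 5 * (m / ε ^ 2) ∧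
      ∀ ψ : Fin a × Fin d → ℂ, IsUnitVector ψ →
        2 / 3 < alg.outputProb ψ (within (reducedState ψ) m ε) := by
  -- A constant answer settles the first two cases; an empty basis admits no unit vector at all.
  by_cases h : (m = 0 ∨ 1 ≤ ε) ∨ IsEmpty (Fin a × Fin d)
  · obtain ⟨alg, h1, h2⟩ := CopyAlgorithm.exists_const a d
      (if m = 0 then (Fintype.card (Fin d) : ℝ) else 0)
    refine ⟨alg, by rw [h1, Nat.cast_zero]; positivity, fun ψ hψ => ?_⟩
    rw [isUnitVector_iff] at hψ
    rcases h with h | h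
    · rw [h2 _ _ (trivial_answer_mem_within m ε hε h hψ)]
      norm_num
    · simp [nsq] at hψ
  · rw [not_or, not_or, not_isEmpty_iff, not_le] at h
    obtain ⟨⟨hm, hε1⟩, hne⟩ := h
    -- Then `1 / k ≤ ε² / 4 < ε² / 3`, and as `ε < 1` rounding up costs at most `1 / ε²`, which
    -- makes the constant `5`.
    set k := ⌈4 / ε ^ 2⌉₊ with hk
    have hk4 : 4 / ε ^ 2 ≤ k := Nat.le_ceil _
    have hk5 : (k : ℝ) < 4 / ε ^ 2 + 1 := Nat.ceil_lt_add_one (by positivity)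
    have hk0 : 0 < (k : ℝ) := lt_of_lt_of_le (by positivity) hk4
    set H := cyclicObservable (Fin a) (Fin d) m
    have hH : H.IsHermitian := isHermitian_cyclicObservable m
    set c := Equiv.curry (Fin k) (Fin m) (Fin a × Fin d)
    obtain ⟨alg, h1, h2⟩ := CopyAlgorithm.exists_measure (I := Fin k × Fin m)
      ((isHermitian_blockAverage k hH).submatrix c)
    refine ⟨alg, ?_, fun ψ hψ => ?_⟩
    · rw [h1, Fintype.card_prod, Fintype.card_fin, Fintype.card_fin, Nat.cast_mul]
      have : (1 : ℝ) ≤ 1 / ε ^ 2 := by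
        rw [le_div_iff₀ (by positivity)]; nlinarith
      calc (k : ℝ) * m ≤ (5 * (1 / ε ^ 2)) * m := by
            gcongr
            rw [show 4 / ε ^ 2 = 4 * (1 / ε ^ 2) by ring] at hk5
            linarith
        _ = 5 * (m / ε ^ 2) := by ring
    · rw [isUnitVector_iff] at hψ
      have hv : nsq (piVec fun _ : Fin m => ψ) = 1 := by rw [nsq_piVec]; simp [hψ]
      refine h2 ψ hψ (powerTrace (reducedState ψ) m) ε _ hε ?_
        fun x hx => (within_mem_iff ψ m ε x).2 hx
      have hc : (piVec fun _ : Fin k × Fin m => ψ)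
          = (piVec fun _ : Fin k => piVec fun _ : Fin m => ψ) ∘ c := by
        ext w
        simp only [piVec, Function.comp_apply, Fintype.prod_prod_type]
        rfl
      rw [hc, nsq_submatrix_mulVec_sub]
      refine (nsq_blockAverage_mulVec_sub_le (by exact_mod_cast hk0.ne') hH hv
        (nsq_cyclicObservable_mulVec_le m hv)
        (star_dotProduct_cyclicObservable_mulVec ψ hm)).trans_lt ?_
      rw [div_lt_iff₀ hk0]
      rw [div_le_iff₀ (by positivity)] at hk4
      linarith

/-! ### Circuits with plain oracle calls -/

section circuits

variable {a d w : ℕ} {Ω : Type*} [Fintype Ω] [DecidableEq Ω]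

/-- The matrix of a plain oracle call in a basis `Ω` of the register. -/
def plainCall (e : Ω ≃ Register w a d) (inv : Bool) (U : Matrix (Fin a × Fin d) (Fin a × Fin d) ℂ) :
    Matrix Ω Ω ℂ :=
  ((⟨inv, false⟩ : OracleCall).toMatrix w U).submatrix e e

lemma plainCall_mem_unitaryGroup (e : Ω ≃ Register w a d) (inv : Bool)
    (U : unitaryGroup (Fin a × Fin d) ℂ) : plainCall e inv U ∈ unitaryGroup Ω ℂ :=
  submatrix_mem_unitaryGroup
    (mem_unitaryGroup_iff'.2 (OracleCall.toMatrix_mem_unitaryGroup _ w U.2)) e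

/-- `Prepares e q v`: the pure state `v U` can be prepared with `q` plain calls to `U` or `U†`. -/
inductive Prepares (e : Ω ≃ Register w a d) :
    ℕ → (unitaryGroup (Fin a × Fin d) ℂ → Ω → ℂ) → Prop
  | init (x : Ω → ℂ) (hx : nsq x = 1) : Prepares e 0 fun _ => x
  | query {q : ℕ} {v : unitaryGroup (Fin a × Fin d) ℂ → Ω → ℂ} (inv : Bool) (A : Matrix Ω Ω ℂ)
      (hA : A ∈ unitaryGroup Ω ℂ) (h : Prepares e q v) :
      Prepares e (q + 1) fun U => A *ᵥ (plainCall e inv U *ᵥ v U)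

/-- `Implements e r F`: the operator `F U` can be applied with `r` plain calls. -/
def Implements (e : Ω ≃ Register w a d) (r : ℕ)
    (F : unitaryGroup (Fin a × Fin d) ℂ → Matrix Ω Ω ℂ) : Prop :=
  ∀ q v, Prepares e q v → Prepares e (q + r) fun U => F U *ᵥ v U

variable {e : Ω ≃ Register w a d}

/-- A fixed gate is free: it merges with the initial vector or with the gate after the last query.
-/
lemma Implements.gate {A : Matrix Ω Ω ℂ} (hA : A ∈ unitaryGroup Ω ℂ) :
    Implements e 0 fun _ => A := by
  intro q v h
  cases h with
  | init x hx => exact .init _ (by rw [nsq_unitary_mulVec hA, hx])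
  | query inv A' hA' h =>
    simp only [mulVec_mulVec _ A A']
    exact .query inv _ (mul_mem hA hA') h

lemma Implements.plainCall (inv : Bool) : Implements e 1 fun U => plainCall e inv U := by
  intro q v h
  simpa using Prepares.query inv 1 (one_mem _) h

lemma Implements.mul {r s : ℕ} {F G : unitaryGroup (Fin a × Fin d) ℂ → Matrix Ω Ω ℂ}
    (hF : Implements e r F) (hG : Implements e s G) : Implements e (s + r) fun U => F U * G U := by
  intro q v h
  simp only [← mulVec_mulVec, ← add_assoc]
  exact hF _ _ (hG _ _ h)

lemma Prepares.nsq_eq_one {q : ℕ} {v : unitaryGroup (Fin a × Fin d) ℂ → Ω → ℂ}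
    (h : Prepares e q v) (U : unitaryGroup (Fin a × Fin d) ℂ) : nsq (v U) = 1 := by
  induction h with
  | init x hx => exact hx
  | query inv A hA h ih =>
    rw [nsq_unitary_mulVec hA, nsq_unitary_mulVec (plainCall_mem_unitaryGroup e inv U), ih]

lemma Prepares.exists_steps {q : ℕ} {v : unitaryGroup (Fin a × Fin d) ℂ → Ω → ℂ}
    (h : Prepares e q v) : ∃ (start : Matrix (Register w a d) (Register w a d) ℂ)
      (steps : List (OracleCall × Channel (Register w a d) (Register w a d))),
      IsDensity start ∧ steps.length = q ∧ (∀ s ∈ steps, s.1.controlled = false) ∧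
      ∀ U : unitaryGroup (Fin a × Fin d) ℂ, steps.foldl
        (fun σ s => s.2.apply (s.1.toMatrix w U * σ * (s.1.toMatrix w (U : Matrix _ _ ℂ))ᴴ)) start
          = ketBra (v U ∘ e.symm) := by
  induction h with
  | init x hx =>
    exact ⟨ketBra (x ∘ e.symm), [], isDensity_ketBra (by rw [nsq_comp_equiv, hx]), rfl, by simp,
      fun _ => rfl⟩
  | query inv A hA h ih =>
    obtain ⟨start, steps, h1, h2, h3, h4⟩ := ih
    refine ⟨start, steps ++ [(⟨inv, false⟩,
      Channel.ofUnitary (submatrix_mem_unitaryGroup hA e.symm))], h1, by simp [h2], ?_,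
      fun U => ?_⟩
    · intro s hs
      rcases List.mem_append.1 hs with hs | hs
      · exact h3 s hs
      · rw [List.mem_singleton.1 hs]
    · rw [List.foldl_append, h4 U, List.foldl_cons, List.foldl_nil, mul_ketBra_mul,
        Channel.ofUnitary_apply_ketBra]
      congr 1
      rw [← submatrix_mulVec_comp _ e.symm e.symm, ← submatrix_mulVec_comp _ e.symm e.symm,
        QuantumQuery.plainCall, submatrix_submatrix, Equiv.self_comp_symm, submatrix_id_id]

/-- Any observable can be measured in a state that can be prepared. -/
lemma Prepares.exists_measure {q : ℕ} {v : unitaryGroup (Fin a × Fin d) ℂ → Ω → ℂ}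
    (h : Prepares e q v) {A : Matrix Ω Ω ℂ} (hA : A.IsHermitian) :
    ∃ alg : UnitaryAlgorithm a d, alg.queries = q ∧ alg.UsesPlainCalls ∧
      ∀ (U : unitaryGroup (Fin a × Fin d) ℂ) (μ ε : ℝ) (S : Set ℝ), 0 < ε →
        nsq (A *ᵥ v U - (μ : ℂ) • v U) < ε ^ 2 / 3 →
        (∀ x, |x - μ| ≤ ε → x ∈ S) → 2 / 3 < alg.outputProb U S := by
  obtain ⟨start, steps, h1, h2, h3, h4⟩ := h.exists_steps
  have hAe := hA.submatrix e.symm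
  refine ⟨⟨w, start, h1, steps, spectralMeasurement hAe⟩, h2, h3, fun U μ ε S hε hvar hS => ?_⟩
  refine lt_of_lt_of_eq (lt_spectralMeasurement_prob hAe (μ := μ)
    (by rw [nsq_comp_equiv, h.nsq_eq_one U]) hε ?_ hS)
    (congrArg (fun σ => (spectralMeasurement hAe).prob σ S) (h4 U).symm)
  rwa [nsq_submatrix_mulVec_sub]

end circuits

/-! ### Block diagonal operators -/

section blockDiagonal

variable {R T : Type*} [Fintype R] [Fintype T] [DecidableEq T]

lemma blockDiagonal_mulVec_apply (M : T → Matrix R R ℂ) (v : R × T → ℂ) (r : R) (t : T) :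
    (blockDiagonal M *ᵥ v) (r, t) = (M t *ᵥ fun r' => v (r', t)) r := by
  simp [mulVec, dotProduct, Fintype.sum_prod_type, blockDiagonal_apply, ite_mul]

variable [DecidableEq R]

lemma blockDiagonal_mem_unitaryGroup {M : T → Matrix R R ℂ}
    (hM : ∀ t, M t ∈ unitaryGroup R ℂ) : blockDiagonal M ∈ unitaryGroup (R × T) ℂ := by
  rw [mem_unitaryGroup_iff, star_eq_conjTranspose, blockDiagonal_conjTranspose,
    ← blockDiagonal_mul, ← blockDiagonal_one]
  congr 1
  funext t
  exact mem_unitaryGroup_iff.1 (hM t)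

lemma permMatrix_mem_unitaryGroup (σ : Equiv.Perm R) :
    Equiv.Perm.permMatrix ℂ σ ∈ unitaryGroup R ℂ := by
  rw [mem_unitaryGroup_iff, star_eq_conjTranspose, conjTranspose_permMatrix, ← permMatrix_mul,
    inv_mul_cancel, permMatrix_one]

end blockDiagonal

/-! ### Parallel oracle calls -/

section parallel

/-- Basis of a control qubit, `m` systems and an auxiliary system. -/
abbrev Cell (m : ℕ) (κ : Type*) : Type _ := Fin 2 × (Fin m → κ) × κ

variable {m N : ℕ} {κ : Type*}

instance [DecidableEq κ] : DecidableEq (Cell m κ) := instDecidableEqProd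

instance {T : Type*} [DecidableEq κ] [DecidableEq T] : DecidableEq (Cell m κ × T) :=
  instDecidableEqProd

/-- Exchange the `i`-th system of a cell with the auxiliary system. -/
def swapSlot (N : ℕ) (κ : Type*) (i : Fin m) : Equiv.Perm (Cell m κ × Fin N) where
  toFun x := ((x.1.1, Function.update x.1.2.1 i x.1.2.2, x.1.2.1 i), x.2)
  invFun x := ((x.1.1, Function.update x.1.2.1 i x.1.2.2, x.1.2.1 i), x.2)
  left_inv x := by simp
  right_inv x := by simp

/-- The matrix applied by a call to the oracle or to its inverse. -/
def orInverse (inv : Bool) (U : Matrix κ κ ℂ) : Matrix κ κ ℂ := if inv then Uᴴ else U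

lemma orInverse_false (U : Matrix κ κ ℂ) : orInverse false U = U := rfl

lemma orInverse_true (U : Matrix κ κ ℂ) : orInverse true U = Uᴴ := rfl

variable [Fintype κ] [DecidableEq κ]

/-- The tensor product of the matrices `M i`, acting on the `m` systems of a cell. -/
def cellTensor (M : Fin m → Matrix κ κ ℂ) : Matrix (Cell m κ) (Cell m κ) ℂ :=
  (1 : Matrix (Fin 2) (Fin 2) ℂ) ⊗ₖ (piTensor (Fin m) κ M ⊗ₖ (1 : Matrix κ κ ℂ))

lemma cellTensor_one : cellTensor (1 : Fin m → Matrix κ κ ℂ) = 1 := by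
  rw [cellTensor, map_one, one_kronecker_one, one_kronecker_one]

lemma cellTensor_mul (M M' : Fin m → Matrix κ κ ℂ) :
    cellTensor (M * M') = cellTensor M * cellTensor M' := by
  simp only [cellTensor, map_mul, ← mul_kronecker_mul, Matrix.one_mul]

lemma conjTranspose_cellTensor (M : Fin m → Matrix κ κ ℂ) :
    (cellTensor M)ᴴ = cellTensor fun i => (M i)ᴴ := by
  simp only [cellTensor, conjTranspose_kronecker, conjTranspose_piTensor, conjTranspose_one]

lemma cellTensor_mem_unitaryGroup {M : Fin m → Matrix κ κ ℂ}
    (hM : ∀ i, M i ∈ unitaryGroup κ ℂ) : cellTensor M ∈ unitaryGroup (Cell m κ) ℂ := by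
  rw [mem_unitaryGroup_iff, star_eq_conjTranspose, conjTranspose_cellTensor, ← cellTensor_mul,
    ← cellTensor_one]
  congr 1
  funext i
  exact mem_unitaryGroup_iff.1 (hM i)

lemma piTensor_mulSingle_apply (i : Fin m) (V : Matrix κ κ ℂ) (w w' : Fin m → κ) :
    piTensor (Fin m) κ (Pi.mulSingle i V) w w'
      = if ∀ j, j ≠ i → w j = w' j then V (w i) (w' i) else 0 := by
  rw [piTensor_apply, ← Finset.mul_prod_erase _ _ (Finset.mem_univ i), Pi.mulSingle_eq_same,
    Finset.prod_congr rfl fun j hj => by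
      rw [Pi.mulSingle_eq_of_ne (Finset.ne_of_mem_erase hj), one_apply],
    Finset.prod_ite_zero]
  simp

variable {a d : ℕ}

/-- The register of an algorithm whose workspace holds a clock and `m` systems. -/
def clockRegister (m N a d : ℕ) : Cell m (Fin a × Fin d) × Fin N ≃
    Register (Fintype.card (Fin N × (Fin m → Fin a × Fin d))) a d where
  toFun x := (x.1.1, Fintype.equivFin _ (x.2, x.1.2.1), x.1.2.2)
  invFun y := ((y.1, ((Fintype.equivFin _).symm y.2.1).2, y.2.2),
    ((Fintype.equivFin _).symm y.2.1).1)
  left_inv x := by simp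
  right_inv y := by simp

/-- The oracle always acts on the auxiliary system. Conjugation by the exchange of systems moves it
to slot `i`, identically at all clock times. -/
lemma plainCall_submatrix_swapSlot (inv : Bool)
    (U : Matrix (Fin a × Fin d) (Fin a × Fin d) ℂ) (i : Fin m) :
    (plainCall (clockRegister m N a d) inv U).submatrix (swapSlot N _ i) (swapSlot N _ i)
      = blockDiagonal fun _ => cellTensor (Pi.mulSingle i (orInverse inv U)) := by
  have hupd : ∀ (w w' : Fin m → Fin a × Fin d) (k k' : Fin a × Fin d),
      Function.update w i k = Function.update w' i k' ↔ (∀ j, j ≠ i → w j = w' j) ∧ k = k' := by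
    intro w w' k k'
    rw [Function.update_eq_iff]
    constructor
    · rintro ⟨h1, h2⟩
      exact ⟨fun j hj => by simpa [hj] using h2 j hj, by simpa using h1⟩
    · rintro ⟨h1, h2⟩
      exact ⟨by simpa using h2, fun j hj => by simpa [hj] using h1 j hj⟩
  ext ⟨⟨b, w, k⟩, t⟩ ⟨⟨b', w', k'⟩, t'⟩
  simp only [plainCall, OracleCall.toMatrix, submatrix_apply, swapSlot, clockRegister,
    Equiv.coe_fn_mk, blockDiagonal_apply, cellTensor,
    kroneckerMap_apply, piTensor_mulSingle_apply, one_apply, Equiv.apply_eq_iff_eq,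
    Prod.mk.injEq, hupd, Bool.false_eq_true, if_false, orInverse]
  generalize (if inv = true then Uᴴ else U) = V
  by_cases hb : b = b' <;> by_cases ht : t = t' <;> by_cases hk : k = k' <;>
    by_cases hw : ∀ j, j ≠ i → w j = w' j <;> simp [hb, ht, hk, hw]

lemma Implements.slot (inv : Bool) (i : Fin m) :
    Implements (clockRegister m N a d) 1
      fun U => blockDiagonal fun _ =>
        cellTensor (Pi.mulSingle i (orInverse inv (U : Matrix _ _ ℂ))) := by
  have hS := permMatrix_mem_unitaryGroup (swapSlot N (Fin a × Fin d) i)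
  have h := (Implements.gate (e := clockRegister m N a d) hS).mul
    ((Implements.plainCall inv).mul (Implements.gate hS))
  intro q v hv
  have h' := h q v hv
  convert h' using 2 with U
  dsimp only
  rw [← plainCall_submatrix_swapSlot, ← mulVec_mulVec, ← mulVec_mulVec, permMatrix_mulVec,
    permMatrix_mulVec, ← submatrix_mulVec_comp _ _ (swapSlot N _ i)]
  congr 1
  ext x
  simp [swapSlot]

lemma Implements.parallel (inv : Bool) :
    Implements (clockRegister m N a d) m
      fun U => blockDiagonal fun _ => cellTensor fun _ => orInverse inv (U : Matrix _ _ ℂ) := by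
  -- The slots are served one after another; `s` is the set of slots already served.
  have h : ∀ s : Finset (Fin m), Implements (clockRegister m N a d) s.card
      fun U => blockDiagonal fun _ => cellTensor fun i =>
        if i ∈ s then orInverse inv (U : Matrix _ _ ℂ) else 1 := by
    intro s
    induction s using Finset.induction_on with
    | empty =>
      have h0 := Implements.gate (e := clockRegister m N a d) (one_mem _)
      simp only [Finset.notMem_empty, if_false, Finset.card_empty]
      have : cellTensor (fun _ : Fin m => (1 : Matrix (Fin a × Fin d) (Fin a × Fin d) ℂ)) = 1 :=
        cellTensor_one
      simp only [this]
      convert h0 using 2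
      exact blockDiagonal_one
    | insert i s hi ih =>
      rw [Finset.card_insert_of_notMem hi]
      have h1 := (Implements.slot (N := N) inv i).mul ih
      convert h1 using 2 with U
      rw [← blockDiagonal_mul]
      congr 1
      funext _
      rw [← cellTensor_mul]
      congr 1
      funext j
      by_cases hj : j = i
      · subst hj; simp [hi]
      · simp [hj]
  simpa using h Finset.univ

end parallel

/-! ### The three-term recurrence of two reflections -/

section recurrence

variable {R : Type*} [Fintype R] [DecidableEq R]

/-- The vectors `(R_Ψ G)^t Ψ`, where `R_Ψ` is the reflection about `Ψ`. -/
def iterate (G : Matrix R R ℂ) (Ψ : R → ℂ) (t : ℕ) : R → ℂ := (reflection Ψ * G) ^ t *ᵥ Ψ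

lemma iterate_succ (G : Matrix R R ℂ) (Ψ : R → ℂ) (t : ℕ) :
    (reflection Ψ * G) *ᵥ iterate G Ψ t = iterate G Ψ (t + 1) := by
  rw [iterate, iterate, mulVec_mulVec, pow_succ']

lemma nsq_iterate {G : Matrix R R ℂ} (hG : G ∈ unitaryGroup R ℂ) {Ψ : R → ℂ} (hΨ : nsq Ψ = 1)
    (t : ℕ) : nsq (iterate G Ψ t) = 1 := by
  rw [iterate, nsq_unitary_mulVec (pow_mem (mul_mem (reflection_mem_unitaryGroup hΨ) hG) t), hΨ]

/-- With `Q = R_Ψ G` one has `Q Ψ = 2 μ Ψ - G Ψ` and, as `G² = 1`, `Q (G Ψ) = Ψ`. Hence `Q² Ψ + Ψ =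
2 μ Q Ψ`, and it remains to apply `Q^t`. -/
lemma iterate_add_iterate {G : Matrix R R ℂ} (hG : G * G = 1) {Ψ : R → ℂ} (hΨ : nsq Ψ = 1)
    {μ : ℝ} (hμ : star Ψ ⬝ᵥ (G *ᵥ Ψ) = μ) (t : ℕ) :
    iterate G Ψ (t + 2) + iterate G Ψ t = (2 * μ : ℂ) • iterate G Ψ (t + 1) := by
  have hR : reflection Ψ *ᵥ Ψ = Ψ := by
    rw [reflection_mulVec, star_dotProduct_self, hΨ, Complex.ofReal_one]; module
  have h1 : (reflection Ψ * G) *ᵥ Ψ = (2 * μ : ℂ) • Ψ - G *ᵥ Ψ := by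
    rw [← mulVec_mulVec, reflection_mulVec, hμ]
  have h2 : (reflection Ψ * G) *ᵥ (G *ᵥ Ψ) = Ψ := by
    rw [mulVec_mulVec, mul_assoc, hG, mul_one, hR]
  have h3 : (reflection Ψ * G) ^ 2 *ᵥ Ψ + Ψ = (2 * μ : ℂ) • ((reflection Ψ * G) *ᵥ Ψ) := by
    have h4 : (reflection Ψ * G) ^ 2 *ᵥ Ψ
        = (reflection Ψ * G) *ᵥ ((2 * μ : ℂ) • Ψ - G *ᵥ Ψ) := by
      rw [sq, ← mulVec_mulVec, h1]
    rw [h4, mulVec_sub, mulVec_smul, h2]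
    abel
  calc iterate G Ψ (t + 2) + iterate G Ψ t
      = (reflection Ψ * G) ^ t *ᵥ ((reflection Ψ * G) ^ 2 *ᵥ Ψ + Ψ) := by
        rw [mulVec_add, mulVec_mulVec, ← pow_add]; rfl
    _ = _ := by rw [h3, mulVec_smul, mulVec_mulVec, ← pow_succ]; rfl

end recurrence

/-! ### The clock -/

section clock

lemma nsq_prod {R T : Type*} [Fintype R] [Fintype T] (v : R × T → ℂ) :
    nsq v = ∑ t, nsq fun r => v (r, t) := by
  simp only [nsq]
  rw [Fintype.sum_prod_type_right]

/-- The unnormalized amplitudes of the clock. -/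
def clockWeight (N t : ℕ) : ℝ := t * (N + 1 - t)

/-- The parameter `y` stands for `N + 1`; it is kept apart from the number of terms so that
induction applies. -/
lemma sum_clockWeight_sq_aux (n : ℕ) (y : ℝ) :
    ∑ t ∈ Finset.range n, (((t + 1 : ℕ) : ℝ) * (y - ((t + 1 : ℕ) : ℝ))) ^ 2
      = y ^ 2 * (n * (n + 1) * (2 * n + 1) / 6) - 2 * y * (n ^ 2 * (n + 1) ^ 2 / 4)
        + n * (n + 1) * (2 * n + 1) * (3 * n ^ 2 + 3 * n - 1) / 30 := by
  induction n with
  | zero => simp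
  | succ n ih =>
    rw [Finset.sum_range_succ, ih]
    push_cast
    ring

lemma sum_clockWeight_sq (N : ℕ) :
    ∑ t : Fin N, clockWeight N (t + 1) ^ 2 = ((N + 1 : ℝ) ^ 5 - (N + 1)) / 30 := by
  rw [Fin.sum_univ_eq_sum_range fun t => clockWeight N (t + 1) ^ 2]
  simp only [clockWeight]
  rw [sum_clockWeight_sq_aux]
  ring

lemma pow_five_le_sum_clockWeight_sq (N : ℕ) :
    (N : ℝ) ^ 5 / 30 ≤ ∑ t : Fin N, clockWeight N (t + 1) ^ 2 := by
  rw [sum_clockWeight_sq]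
  have : (0 : ℝ) ≤ N := Nat.cast_nonneg N
  gcongr
  have h : (N + 1 : ℝ) ^ 5 - (N + 1) - N ^ 5 = 5 * N ^ 4 + 10 * N ^ 3 + 10 * N ^ 2 + 4 * N := by
    ring
  have h2 : (0 : ℝ) ≤ 5 * N ^ 4 + 10 * N ^ 3 + 10 * N ^ 2 + 4 * N := by positivity
  linarith

/-- The increment is `N - 2 t`, one order in `N` below the typical weight `N²`. This ratio is what
gives precision `1 / N`. -/
lemma clockWeight_diff_sq_le {N t : ℕ} (h : t ≤ N) :
    (clockWeight N (t + 1) - clockWeight N t) ^ 2 ≤ (N : ℝ) ^ 2 := by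
  have ht : (t : ℝ) ≤ N := by exact_mod_cast h
  have h0 : (0 : ℝ) ≤ t := Nat.cast_nonneg t
  have : clockWeight N (t + 1) - clockWeight N t = N - 2 * t := by
    simp only [clockWeight]; push_cast; ring
  rw [this]
  exact sq_le_sq' (by linarith) (by linarith)

/-- Half the adjacency matrix of a path, acting on the clock. -/
def clockObservable (R : Type*) [DecidableEq R] (N : ℕ) : Matrix (R × Fin N) (R × Fin N) ℂ :=
  Matrix.of fun x y => if x.1 = y.1 then
    (1 / 2) * ((if (y.2 : ℕ) = x.2 + 1 then 1 else 0) + if (x.2 : ℕ) = y.2 + 1 then 1 else 0)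
  else 0

lemma isHermitian_clockObservable (R : Type*) [DecidableEq R] (N : ℕ) :
    (clockObservable R N).IsHermitian := by
  ext x y
  simp only [conjTranspose_apply, clockObservable, of_apply, eq_comm (a := y.1)]
  split_ifs <;> simp

/-- The state of clock and system when the system is in the state `u t` at the time `t`. -/
def clockState {R : Type*} (N : ℕ) (c : ℝ) (u : ℕ → R → ℂ) : R × Fin N → ℂ :=
  fun x => ((c * clockWeight N (x.2 + 1) : ℝ) : ℂ) * u (x.2 + 1) x.1

variable {R : Type*} [Fintype R]

lemma nsq_clockState (N : ℕ) (c : ℝ) {u : ℕ → R → ℂ} (hu : ∀ t, nsq (u t) = 1) :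
    nsq (clockState N c u) = c ^ 2 * ∑ t : Fin N, clockWeight N (t + 1) ^ 2 := by
  rw [nsq_prod, Finset.mul_sum]
  refine Finset.sum_congr rfl fun t _ => ?_
  have : (fun r => clockState N c u (r, t))
      = ((c * clockWeight N (t + 1) : ℝ) : ℂ) • u (t + 1) := rfl
  rw [this, nsq_smul, hu, Complex.norm_real, Real.norm_eq_abs, sq_abs, mul_pow, mul_one]

variable [DecidableEq R]

lemma clockObservable_mulVec_clockState (N : ℕ) (c : ℝ) (u : ℕ → R → ℂ) (r : R) (t : Fin N) :
    (clockObservable R N *ᵥ clockState N c u) (r, t)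
      = (1 / 2) * (((c * clockWeight N (t + 2) : ℝ) : ℂ) * u (t + 2) r
        + ((c * clockWeight N t : ℝ) : ℂ) * u t r) := by
  -- Position `s` of the clock stands for the time `s + 1`. The missing times `0` and `N + 1` do no
  -- harm because the weight vanishes there.
  have key : ∀ n : ℕ, n ≤ N + 1 → ∑ s : Fin N, (if (s : ℕ) + 1 = n then (1 : ℂ) else 0)
      * (((c * clockWeight N (s + 1) : ℝ) : ℂ) * u (s + 1) r)
        = ((c * clockWeight N n : ℝ) : ℂ) * u n r := by
    intro n hn
    by_cases h : 1 ≤ n ∧ n ≤ N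
    · rw [Finset.sum_eq_single (⟨n - 1, by omega⟩ : Fin N)]
      · have : n - 1 + 1 = n := by omega
        simp [this]
      · intro s _ hs
        have : (s : ℕ) + 1 ≠ n := fun hc => hs (Fin.ext (by simp; omega))
        simp [this]
      · simp
    · rw [Finset.sum_eq_zero]
      · have : n = 0 ∨ n = N + 1 := by omega
        rcases this with rfl | rfl <;> simp [clockWeight]
      · intro s _
        have : (s : ℕ) + 1 ≠ n := by omega
        simp [this]
  rw [← key (t + 2) (by omega), ← key t (by omega), ← Finset.sum_add_distrib, Finset.mul_sum]
  simp only [mulVec, dotProduct, Fintype.sum_prod_type_right, clockObservable, of_apply, ite_mul,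
    zero_mul, Finset.sum_ite_eq, Finset.mem_univ, if_true, clockState]
  refine Finset.sum_congr rfl fun s _ => ?_
  have h1 : ((s : ℕ) = t + 1) = ((s : ℕ) + 1 = t + 2) := by simp
  have h2 : ((t : ℕ) = s + 1) = ((s : ℕ) + 1 = t) := by rw [eq_comm (a := (t : ℕ))]
  simp only [h1, h2]
  split_ifs <;> ring

/-- By the recurrence, `μ w u_{t+1}` is half of `w (u_{t+2} + u_t)`. Subtracting it leaves only
increments of the weight, each at most `N` in absolute value, at `N` clock positions. -/
lemma nsq_clockObservable_mulVec_sub_le (N : ℕ) (c μ : ℝ) {u : ℕ → R → ℂ}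
    (hu : ∀ t, nsq (u t) = 1)
    (hrec : ∀ t, u (t + 2) + u t = (2 * μ : ℂ) • u (t + 1)) :
    nsq (clockObservable R N *ᵥ clockState N c u - (μ : ℂ) • clockState N c u)
      ≤ c ^ 2 * N ^ 3 := by
  rw [nsq_prod]
  have h : ∀ t : Fin N, nsq (fun r => (clockObservable R N *ᵥ clockState N c u
      - (μ : ℂ) • clockState N c u) (r, t)) ≤ c ^ 2 * N ^ 2 := by
    intro t
    have h1 : (fun r => (clockObservable R N *ᵥ clockState N c u
        - (μ : ℂ) • clockState N c u) (r, t))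
        = (1 / 2 : ℂ) • (((c * (clockWeight N (t + 2) - clockWeight N (t + 1)) : ℝ) : ℂ) • u (t + 2)
          + ((c * (clockWeight N t - clockWeight N (t + 1)) : ℝ) : ℂ) • u t) := by
      funext r
      have h2 := congrFun (hrec t) r
      simp only [Pi.add_apply, Pi.smul_apply, smul_eq_mul] at h2
      simp only [Pi.sub_apply, clockObservable_mulVec_clockState, Pi.add_apply, Pi.smul_apply,
        smul_eq_mul, clockState]
      push_cast
      linear_combination (c * clockWeight N (t + 1) / 2 : ℂ) * h2
    rw [h1]
    refine (nsq_half_smul_add_le _ _ _ _).trans ?_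
    rw [hu, hu, mul_pow, mul_pow, mul_one, mul_one]
    have h3 := clockWeight_diff_sq_le (N := N) (t := t + 1) (by omega)
    have h4 := clockWeight_diff_sq_le (N := N) (t := t) (by omega)
    have h5 : (clockWeight N t - clockWeight N (t + 1)) ^ 2 ≤ (N : ℝ) ^ 2 := by
      rw [← neg_sub, neg_sq]; exact h4
    have hc := sq_nonneg c
    nlinarith
  calc _ ≤ ∑ _ : Fin N, c ^ 2 * (N : ℝ) ^ 2 := Finset.sum_le_sum fun t _ => h t
    _ = c ^ 2 * N ^ 3 := by simp; ring

/-- One step of the clock: the operator `Q` is applied at all times from `s` on. -/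
lemma blockDiagonal_mulVec_clockState (N : ℕ) (c : ℝ) (Q : Matrix R R ℂ) {u : ℕ → R → ℂ}
    (hQ : ∀ t, Q *ᵥ u t = u (t + 1)) (s : ℕ) :
    (blockDiagonal fun t : Fin N => if s ≤ (t : ℕ) then Q else 1) *ᵥ
        clockState N c (fun t => u (min s t)) = clockState N c fun t => u (min (s + 1) t) := by
  ext ⟨r, t⟩
  rw [blockDiagonal_mulVec_apply]
  have h : (fun r' => clockState N c (fun t => u (min s t)) (r', t))
      = ((c * clockWeight N (t + 1) : ℝ) : ℂ) • u (min s (t + 1)) := rfl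
  rw [h, mulVec_smul, Pi.smul_apply, smul_eq_mul, clockState]
  congr 1
  dsimp only
  by_cases hs : s ≤ t
  · rw [if_pos hs, min_eq_left (by omega), hQ, min_eq_left (by omega)]
  · rw [if_neg hs, one_mulVec, min_eq_right (by omega), min_eq_right (by omega)]

end clock

/-! ### Amplitude estimation -/

section cell

variable {m : ℕ} {κ : Type*}

/-- The product of a uniform control qubit, the state `f` of the `m` systems and the state `g` of
the auxiliary system. -/
def cellVec (f : (Fin m → κ) → ℂ) (g : κ → ℂ) : Cell m κ → ℂ :=
  fun x => ((√2)⁻¹ : ℝ) * (f x.2.1 * g x.2.2)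

/-- Flip the control qubit and cyclically permute the second components, in a direction given by
the control qubit. -/
def cyclicFlip (m : ℕ) (α β : Type*) : Equiv.Perm (Cell m (α × β)) where
  toFun x := (x.1 + 1,
    (if x.1 = 0 then permuteB (finRotate m) x.2.1 else (permuteB (finRotate m)).symm x.2.1), x.2.2)
  invFun x := (x.1 + 1,
    (if x.1 = 0 then permuteB (finRotate m) x.2.1 else (permuteB (finRotate m)).symm x.2.1), x.2.2)
  left_inv x := by
    obtain ⟨b, w, k⟩ := x
    fin_cases b <;> simp
  right_inv x := by
    obtain ⟨b, w, k⟩ := x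
    fin_cases b <;> simp

/-- The permutation matrix of `cyclicFlip`. -/
def flipMatrix (m : ℕ) (α β : Type*) [DecidableEq α] [DecidableEq β] :
    Matrix (Cell m (α × β)) (Cell m (α × β)) ℂ :=
  Equiv.Perm.permMatrix ℂ (cyclicFlip m α β)

variable [Fintype κ]

lemma star_cellVec_dotProduct_cellVec (f f' : (Fin m → κ) → ℂ) (g g' : κ → ℂ) :
    star (cellVec f g) ⬝ᵥ cellVec f' g' = (star f ⬝ᵥ f') * (star g ⬝ᵥ g') := by
  have h2 : ((((√2)⁻¹ : ℝ) : ℂ)) * (((√2)⁻¹ : ℝ) : ℂ) = 1 / 2 := by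
    rw [← Complex.ofReal_mul, ← mul_inv, Real.mul_self_sqrt (by norm_num)]
    norm_num
  simp only [dotProduct, Fintype.sum_prod_type, cellVec, Pi.star_apply, star_mul', Complex.star_def,
    Complex.conj_ofReal, Fin.sum_univ_two, Finset.sum_mul_sum, ← Finset.sum_add_distrib]
  refine Finset.sum_congr rfl fun x _ => Finset.sum_congr rfl fun y _ => ?_
  linear_combination (2 * (starRingEnd ℂ) (f x) * (starRingEnd ℂ) (g y) * f' x * g' y) * h2

lemma nsq_cellVec {f : (Fin m → κ) → ℂ} {g : κ → ℂ} (hf : nsq f = 1) (hg : nsq g = 1) :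
    nsq (cellVec f g) = 1 := by
  have h := star_cellVec_dotProduct_cellVec f f g g
  rw [star_dotProduct_self, star_dotProduct_self, star_dotProduct_self, hf, hg,
    Complex.ofReal_one, mul_one] at h
  exact_mod_cast h

lemma cellTensor_mulVec_cellVec [DecidableEq κ] (M : Fin m → Matrix κ κ ℂ)
    (f : (Fin m → κ) → ℂ) (g : κ → ℂ) :
    cellTensor M *ᵥ cellVec f g = cellVec (piTensor (Fin m) κ M *ᵥ f) g := by
  ext ⟨b, w, k⟩
  simp only [mulVec, dotProduct, Fintype.sum_prod_type, cellTensor, kroneckerMap_apply, one_apply,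
    cellVec, ite_mul, one_mul, zero_mul, mul_ite, mul_one, mul_zero, Finset.sum_ite_irrel,
    Finset.sum_const_zero, Finset.sum_ite_eq, Finset.mem_univ, if_true, Finset.mul_sum,
    Finset.sum_mul]
  exact Finset.sum_congr rfl fun x _ => by ring

variable {α β : Type*} [Fintype α] [DecidableEq α] [Fintype β] [DecidableEq β]

lemma flipMatrix_mem_unitaryGroup : flipMatrix m α β ∈ unitaryGroup (Cell m (α × β)) ℂ :=
  permMatrix_mem_unitaryGroup _

/-- The flip of the control qubit reverses the direction, so the second application undoes the
first. The cyclic permutation alone is not an involution in general. -/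
lemma flipMatrix_mul_self : flipMatrix m α β * flipMatrix m α β = 1 := by
  rw [flipMatrix, ← permMatrix_mul]
  have : cyclicFlip m α β * cyclicFlip m α β = 1 := inv_eq_iff_mul_eq_one.1 rfl
  rw [this, permMatrix_one]

/-- The uniform control qubit is invariant under the flip, so the mean is the average over the two
directions, both of which give the power trace. -/
lemma star_cellVec_dotProduct_flipMatrix_mulVec (ψ : α × β → ℂ) (hm : m ≠ 0) {g : α × β → ℂ}
    (hg : nsq g = 1) :
    star (cellVec (piVec fun _ : Fin m => ψ) g) ⬝ᵥ
        (flipMatrix m α β *ᵥ cellVec (piVec fun _ => ψ) g)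
      = powerTrace (reducedState ψ) m := by
  set f := piVec fun _ : Fin m => ψ with hf
  have h1 := star_piVec_dotProduct_comp_permuteB_finRotate ψ hm
  have h2 := star_piVec_dotProduct_comp_permuteB_finRotate_symm ψ hm
  rw [← hf] at h1 h2
  have h3 := star_cellVec_dotProduct_cellVec f (f ∘ permuteB (finRotate m)) g g
  have h4 := star_cellVec_dotProduct_cellVec f (f ∘ (permuteB (finRotate m)).symm) g g
  rw [star_dotProduct_self, hg, h1, Complex.ofReal_one, mul_one] at h3
  rw [star_dotProduct_self, hg, h2, Complex.ofReal_one, mul_one] at h4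
  rw [flipMatrix, permMatrix_mulVec]
  simp only [dotProduct, Fintype.sum_prod_type, Fin.sum_univ_two] at h3 h4 ⊢
  have e0 : ∀ w k, (cellVec f g ∘ cyclicFlip m α β) (0, w, k)
      = cellVec (f ∘ permuteB (finRotate m)) g (0, w, k) := fun w k => rfl
  have e1 : ∀ w k, (cellVec f g ∘ cyclicFlip m α β) (1, w, k)
      = cellVec (f ∘ (permuteB (finRotate m)).symm) g (1, w, k) := fun w k => rfl
  have e2 : ∀ (f' : (Fin m → α × β) → ℂ) w k, cellVec f' g (1, w, k) = cellVec f' g (0, w, k) :=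
    fun f' w k => rfl
  simp only [e0, e1, e2, Pi.star_apply] at h3 h4 ⊢
  linear_combination (1 / 2 : ℂ) * h3 + (1 / 2 : ℂ) * h4

end cell

/-! ### Preparation of the clock state -/

section estimation

variable {m N a d : ℕ} [NeZero a] [NeZero d]

/-- All systems of a cell in their basis states `|0⟩`. -/
def zeroCell (m a d : ℕ) [NeZero a] [NeZero d] : Cell m (Fin a × Fin d) → ℂ :=
  cellVec (piVec fun _ => Pi.single (0, 0) 1) (Pi.single (0, 0) 1)

/-- All systems of a cell in the state prepared by the oracle. -/
def preparedCell (m : ℕ) (U : Matrix (Fin a × Fin d) (Fin a × Fin d) ℂ) :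
    Cell m (Fin a × Fin d) → ℂ :=
  cellVec (piVec fun _ => preparedState U) (Pi.single (0, 0) 1)

lemma cellTensor_mulVec_zeroCell (U : Matrix (Fin a × Fin d) (Fin a × Fin d) ℂ) :
    (cellTensor fun _ => U) *ᵥ zeroCell m a d = preparedCell m U := by
  rw [zeroCell, cellTensor_mulVec_cellVec, piTensor_mulVec_piVec]
  rfl

lemma nsq_zeroCell : nsq (zeroCell m a d) = 1 :=
  nsq_cellVec (by rw [nsq_piVec]; simp only [nsq_single, Finset.prod_const_one]) (nsq_single _)

lemma nsq_preparedState (U : unitaryGroup (Fin a × Fin d) ℂ) :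
    nsq (preparedState (U : Matrix (Fin a × Fin d) (Fin a × Fin d) ℂ)) = 1 := by
  rw [preparedState, nsq_unitary_mulVec U.2, nsq_single]

lemma nsq_preparedCell (U : unitaryGroup (Fin a × Fin d) ℂ) :
    nsq (preparedCell m (U : Matrix (Fin a × Fin d) (Fin a × Fin d) ℂ)) = 1 := by
  rw [← cellTensor_mulVec_zeroCell,
    nsq_unitary_mulVec (cellTensor_mem_unitaryGroup fun _ => U.2), nsq_zeroCell]

/-- Write `R_Ψ = W R₀ W†`, where `W` is the parallel oracle call. Only the known gates `R₀` and `G`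
depend on the clock; where they are switched off, `W W† = 1`. Thus no controlled oracle call is
needed. -/
lemma Implements.clockStep (s : ℕ) :
    Implements (clockRegister m N a d) (2 * m) fun U => blockDiagonal fun t : Fin N =>
      if s ≤ (t : ℕ) then
        reflection (preparedCell m (U : Matrix _ _ ℂ)) * flipMatrix m (Fin a) (Fin d) else 1 := by
  have hR : ∀ t : Fin N, (if s ≤ (t : ℕ) then reflection (zeroCell m a d) else 1)
      ∈ unitaryGroup (Cell m (Fin a × Fin d)) ℂ := fun t => by
    split_ifs
    · exact reflection_mem_unitaryGroup nsq_zeroCell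
    · exact one_mem _
  have hG : ∀ t : Fin N, (if s ≤ (t : ℕ) then flipMatrix m (Fin a) (Fin d) else 1)
      ∈ unitaryGroup (Cell m (Fin a × Fin d)) ℂ := fun t => by
    split_ifs
    · exact flipMatrix_mem_unitaryGroup
    · exact one_mem _
  have h := (Implements.parallel (m := m) (N := N) (a := a) (d := d) false).mul
    ((Implements.gate (blockDiagonal_mem_unitaryGroup hR)).mul
      ((Implements.parallel true).mul (Implements.gate (blockDiagonal_mem_unitaryGroup hG))))
  have hq : 0 + m + 0 + m = 2 * m := by ring
  rw [hq] at h
  convert h using 2 with U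
  rw [← blockDiagonal_mul, ← blockDiagonal_mul, ← blockDiagonal_mul]
  congr 1
  funext t
  have hW : (cellTensor fun _ : Fin m => (U : Matrix (Fin a × Fin d) (Fin a × Fin d) ℂ))
      ∈ unitaryGroup _ ℂ := cellTensor_mem_unitaryGroup fun _ => U.2
  have hinv : (cellTensor fun _ : Fin m => orInverse true (U : Matrix _ _ ℂ))
      = (cellTensor fun _ : Fin m => (U : Matrix (Fin a × Fin d) (Fin a × Fin d) ℂ))ᴴ := by
    rw [conjTranspose_cellTensor, orInverse_true]
  rw [hinv, orInverse_false, ← cellTensor_mulVec_zeroCell,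
    ← mul_reflection_mul hW]
  split_ifs
  · simp only [mul_assoc]
  · rw [mul_one, one_mul, ← star_eq_conjTranspose, mem_unitaryGroup_iff.1 hW]

/-- After one parallel call and `s` clock steps, the branch of time `t` contains the iterate `min s
t`; after `N` steps every branch has reached its own time. -/
lemma Prepares.clockState {c : ℝ} (hc : c ^ 2 * ∑ t : Fin N, clockWeight N (t + 1) ^ 2 = 1) :
    Prepares (clockRegister m N a d) (m + 2 * m * N) fun U => QuantumQuery.clockState N c
      (iterate (flipMatrix m (Fin a) (Fin d)) (preparedCell m (U : Matrix _ _ ℂ))) := by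
  have h : ∀ s : ℕ, Prepares (clockRegister m N a d) (m + 2 * m * s) fun U =>
      QuantumQuery.clockState N c fun t =>
        iterate (flipMatrix m (Fin a) (Fin d)) (preparedCell m (U : Matrix _ _ ℂ)) (min s t) := by
    intro s
    induction s with
    | zero =>
      have h0 := (Implements.parallel (m := m) (N := N) (a := a) (d := d) false) _ _
        (Prepares.init (QuantumQuery.clockState N c fun _ => zeroCell m a d)
          (by rw [nsq_clockState N c fun _ => nsq_zeroCell, hc]))
      rw [zero_add] at h0
      rw [mul_zero, add_zero]
      convert h0 using 2 with U
      ext ⟨r, t⟩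
      dsimp only
      rw [blockDiagonal_mulVec_apply]
      have h1 : (fun r' => QuantumQuery.clockState N c (fun _ => zeroCell m a d) (r', t))
          = ((c * clockWeight N (t + 1) : ℝ) : ℂ) • zeroCell m a d := rfl
      rw [h1, mulVec_smul, orInverse_false,
        cellTensor_mulVec_zeroCell]
      simp [QuantumQuery.clockState, iterate]
    | succ s ih =>
      have h1 := Implements.clockStep s _ _ ih
      rw [show m + 2 * m * (s + 1) = m + 2 * m * s + 2 * m by ring]
      convert h1 using 2 with U
      exact (blockDiagonal_mulVec_clockState N c _ (iterate_succ _ _) s).symm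
  convert h N using 2 with U
  ext ⟨r, t⟩
  simp only [QuantumQuery.clockState]
  rw [min_eq_right (by omega)]

end estimation

/-- A unitary algorithm that reports the constant `c` without any query. -/
lemma UnitaryAlgorithm.exists_const (a d : ℕ) [NeZero a] [NeZero d] (c : ℝ) :
    ∃ alg : UnitaryAlgorithm a d, alg.queries = 0 ∧ alg.UsesPlainCalls ∧
      ∀ U S, c ∈ S → alg.outputProb U S = 1 := by
  refine ⟨⟨1, ketBra (Pi.single (0, 0, 0, 0) 1), isDensity_ketBra (nsq_single _), [],
    ⟨1, fun _ => 1, fun _ => PosSemidef.one, by simp, fun _ => c⟩⟩, rfl, by simp [UsesPlainCalls],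
    fun U S hS => ?_⟩
  simp [outputProb, finalState, Measurement.prob, hS, trace_ketBra, nsq_single]

theorem unitaryAlgorithm_upper_bound (a d m : ℕ) [NeZero a] [NeZero d] (ε : ℝ) (hε : 0 < ε) :
    ∃ alg : UnitaryAlgorithm a d, (alg.queries : ℝ) ≤ 23 * (m / ε) ∧ alg.UsesPlainCalls ∧
      ∀ U ∈ unitaryGroup (Fin a × Fin d) ℂ,
        2 / 3 < alg.outputProb U (within (reducedState (preparedState U)) m ε) := by
  by_cases h : m = 0 ∨ 1 ≤ ε
  · obtain ⟨alg, h1, h2, h3⟩ := UnitaryAlgorithm.exists_const a d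
      (if m = 0 then (Fintype.card (Fin d) : ℝ) else 0)
    refine ⟨alg, by rw [h1, Nat.cast_zero]; positivity, h2, fun U hU => ?_⟩
    rw [h3 _ _ (trivial_answer_mem_within m ε hε h (nsq_preparedState ⟨U, hU⟩))]
    norm_num
  · rw [not_or, not_le] at h
    obtain ⟨hm, hε1⟩ := h
    -- The variance is then at most `30 / N² ≤ 3 ε² / 10 < ε² / 3`. The cost `m (1 + 2 N)` is at
    -- most `m (3 + 20 / ε)`, hence at most `23 m / ε` as `ε < 1`.
    set N := ⌈10 / ε⌉₊ with hN
    have hN1 : 10 / ε ≤ N := Nat.le_ceil _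
    have hN2 : (N : ℝ) < 10 / ε + 1 := Nat.ceil_lt_add_one (by positivity)
    have hN0 : 0 < (N : ℝ) := lt_of_lt_of_le (by positivity) hN1
    set s := ∑ t : Fin N, clockWeight N (t + 1) ^ 2 with hs
    have hs5 : (N : ℝ) ^ 5 / 30 ≤ s := pow_five_le_sum_clockWeight_sq N
    have hs0 : 0 < s := lt_of_lt_of_le (by positivity) hs5
    have hc : (√s)⁻¹ ^ 2 = s⁻¹ := by rw [inv_pow, Real.sq_sqrt hs0.le]
    obtain ⟨alg, h1, h2, h3⟩ := (Prepares.clockState (m := m) (N := N) (a := a) (d := d)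
      (c := (√s)⁻¹) (by rw [hc, inv_mul_cancel₀ hs0.ne'])).exists_measure
      (isHermitian_clockObservable _ N)
    refine ⟨alg, ?_, h2, fun U hU => ?_⟩
    · have h4 : (1 : ℝ) ≤ 1 / ε := by rw [le_div_iff₀ hε]; linarith
      rw [h1]
      push_cast
      calc (m : ℝ) + 2 * m * N = m * (1 + 2 * N) := by ring
        _ ≤ m * (23 * (1 / ε)) := by
          gcongr
          rw [show 10 / ε = 10 * (1 / ε) by ring] at hN2
          linarith
        _ = 23 * (m / ε) := by ring
    · refine h3 ⟨U, hU⟩ (powerTrace (reducedState (preparedState U)) m) ε _ hε ?_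
        fun x hx => (within_mem_iff _ m ε x).2 hx
      have hΨ := nsq_preparedCell (m := m) ⟨U, hU⟩
      refine (nsq_clockObservable_mulVec_sub_le N _ _
        (nsq_iterate flipMatrix_mem_unitaryGroup hΨ)
        (iterate_add_iterate flipMatrix_mul_self hΨ
          (star_cellVec_dotProduct_flipMatrix_mulVec _ hm (nsq_single _)))).trans_lt ?_
      rw [hc, inv_mul_lt_iff₀ hs0]
      have h5 : 10 ≤ N * ε := by rwa [div_le_iff₀ hε] at hN1
      have h6 : 100 ≤ (N : ℝ) ^ 2 * ε ^ 2 := by rw [← mul_pow]; nlinarith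
      calc (N : ℝ) ^ 3 < N ^ 3 * ((N ^ 2 * ε ^ 2) / 90) := by
            refine lt_mul_of_one_lt_right (by positivity) ?_
            linarith
        _ = N ^ 5 / 30 * (ε ^ 2 / 3) := by ring
        _ ≤ s * (ε ^ 2 / 3) := by gcongr

end QuantumQuery

end

/-! ### The four bounds together -/

theorem mainTheorem9 :
    -- copy-producing oracle: `O(m / ε²)` queries suffice
    ((∃ C : ℝ, 0 < C ∧ ∀ (n a m : ℕ) (ε : ℝ), 0 < ε →
        ∃ alg : QuantumQuery.CopyAlgorithm a (2 ^ n),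
          (alg.queries : ℝ) ≤ C * (m / ε ^ 2) ∧
          ∀ ψ : Fin a × Fin (2 ^ n) → ℂ, QuantumQuery.IsUnitVector ψ →
            2 / 3 < alg.outputProb ψ
              (QuantumQuery.within (QuantumQuery.reducedState ψ) m ε)) ∧
    -- copy-producing oracle: `Ω(m)` queries are necessary
      (∃ c : ℝ, 0 < c ∧ ∃ m₀ : ℕ, ∀ (n a m : ℕ), 1 ≤ n → 2 ≤ a → m₀ ≤ m →
        ∀ alg : QuantumQuery.CopyAlgorithm a (2 ^ n),
          (∀ ψ : Fin a × Fin (2 ^ n) → ℂ, QuantumQuery.IsUnitVector ψ →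
            2 / 3 ≤ alg.outputProb ψ
              (QuantumQuery.strictlyWithin (QuantumQuery.reducedState ψ) m (1 / 3))) →
          c * m ≤ alg.queries)) ∧
    -- unitary oracle with known inverse: `O(m / ε)` queries suffice
    ((∃ C : ℝ, 0 < C ∧ ∀ (n a m : ℕ) [NeZero a] (ε : ℝ), 0 < ε →
        ∃ alg : QuantumQuery.UnitaryAlgorithm a (2 ^ n),
          (alg.queries : ℝ) ≤ C * (m / ε) ∧ alg.UsesPlainCalls ∧
          ∀ U ∈ Matrix.unitaryGroup (Fin a × Fin (2 ^ n)) ℂ,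
            2 / 3 < alg.outputProb U
              (QuantumQuery.within
                (QuantumQuery.reducedState (QuantumQuery.preparedState U)) m ε)) ∧
    -- unitary oracle with known inverse: `Ω(√m)` queries are necessary
      (∃ c : ℝ, 0 < c ∧ ∃ m₀ : ℕ, ∀ (n a m : ℕ) [NeZero a], 1 ≤ n → 2 ≤ a → m₀ ≤ m →
        ∀ alg : QuantumQuery.UnitaryAlgorithm a (2 ^ n),
          (∀ U ∈ Matrix.unitaryGroup (Fin a × Fin (2 ^ n)) ℂ,
            2 / 3 ≤ alg.outputProb U
              (QuantumQuery.strictlyWithin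
                (QuantumQuery.reducedState (QuantumQuery.preparedState U)) m (1 / 3))) →
          c * √(m : ℝ) ≤ alg.queries)) := by
  have two_le : ∀ n : ℕ, 1 ≤ n → 2 ≤ 2 ^ n := fun n hn => Nat.le_self_pow (by omega) 2
  exact ⟨⟨⟨5, by norm_num, fun n a m ε hε =>
      QuantumQuery.copyAlgorithm_upper_bound a (2 ^ n) m ε hε⟩,
    ⟨1 / 144, by norm_num, 20, fun n a m hn ha hm alg h =>
      QuantumQuery.copyAlgorithm_lower_bound ha (two_le n hn) hm alg h⟩⟩,
    ⟨⟨23, by norm_num, fun n a m _ ε hε =>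
      QuantumQuery.unitaryAlgorithm_upper_bound a (2 ^ n) m ε hε⟩,
    ⟨1 / 18, by norm_num, 20, fun n a m _ hn ha hm alg h =>
      QuantumQuery.unitaryAlgorithm_lower_bound ha (two_le n hn) hm alg h⟩⟩⟩
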